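/- Let $\Lambda=2\mathbb Z\times2\mathbb Z\times2\mathbb Z\subset\mathbb R^3$, let $L_b$ denote the translation $x\mapsto x+b$, and let $$\tau=\begin{pmatrix}0&-1&0\\1&0&0\\0&0&1\end{pmatrix},\qquad \chi_1=\operatorname{diag}(1,-1,-1),\quad \chi_2=\operatorname{diag}(-1,1,-1),\quad \chi_3=\operatorname{diag}(-1,-1,1).$$ Let $\Gamma_1$ be the group of isometries of Euclidean $\mathbb R^3$ generated by $\{L_\lambda:\lambda\in\Lambda\}$ and $\tau$, and let $\Gamma_2$ be generated by $\{L_\lambda:\lambda\in\Lambda\}$ and $\chi_1,\chi_2,\chi_3$. Then, with $\chi_0:=\mathrm{Id}$, $$\Gamma_1=\{\tau^jL_\lambda : 0\le j\le 3,\ \lambda\in\Lambda\},\qquad \Gamma_2=\{\chi_jL_\lambda : 0\le j\le 3,\ \lambda\in\Lambda\}.$$ Both groups act properly discontinuously on $\mathbb R^3$ with compact quotient, so $\mathcal O_i:=\Gamma_i\backslash\mathbb R^3$ ($i=1,2$) are compact flat orbifolds. (Smooth functions and forms on $\mathcal O_i$ are the $\Gamma_i$-invariant ones on $\mathbb R^3$;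 the Laplace operator on $k$-forms is the restriction of $dd^*+d^*d$; isospectral means having the same eigenvalues with the same multiplicities. The isotropy group of a point of $\mathcal O_i$ is the stabilizer in $\Gamma_i$ of any of its preimages in $\mathbb R^3$, up to isomorphism; its isotropy order is the order of that group; the point is singular if this group is nontrivial.) The following hold. 1. $\mathcal O_1$ and $\mathcal O_2$ are isospectral on functions, but not on $1$-forms. 2. The maximal isotropy order is $4$ in both $\mathcal O_1$ and $\mathcal O_2$. Every point of maximal isotropy order has isotropy group isomorphic to $\mathbb Z_4$ in $\mathcal O_1$, and isomorphic to $\mathbb Z_2\times\mathbb Z_2$ in $\mathcal O_2$; these groups are not isomorphic. 3. The set of points of maximal isotropy order has (topological) dimension $1$ in $\mathcal O_1$ and $0$ in $\mathcal O_2$. 4. Every singular point of $\mathcal O_1$ has isotropy group $\mathbb Z_4$ or $\mathbb Z_2$. The points with isotropy group $\mathbb Z_4$ form two disjoint circles of length $2$, and those with isotropy group $\mathbb Z_2$ form one circle of length $2$. (Here a circle of length $\ell$ is the image of a unit-speed straight line in $\mathbb R^3$ which descends to a closed curve of period $\ell$ that is injective on a period.) 5. A point of $\mathbb R^3$ projects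 to a point of $\mathcal O_2$ with isotropy group $\mathbb Z_2\times\mathbb Z_2$ if and only if all its coordinates are integers, and to one with isotropy group $\mathbb Z_2$ if and only if exactly two of its coordinates are integers; these are all the singular points. In $\mathcal O_2$ there are exactly eight points with isotropy group $\mathbb Z_2\times\mathbb Z_2$, and the points with isotropy group $\mathbb Z_2$ form twelve disjoint open segments of length one (injective images of open straight segments of length one in $\mathbb R^3$). -/

import Mathlib

noncomputable section

namespace FlatOrbifold

open Set
open scoped ContDiff

/-! ### Isometries of Euclidean space and their orbit spaces -/

/-- Euclidean space `ℝⁿ`. -/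
abbrev E (n : ℕ) : Type := EuclideanSpace ℝ (Fin n)

/-- The isometry group `I(ℝⁿ) = O(n) ⋉ ℝⁿ`. -/
abbrev Isom (n : ℕ) : Type := E n ≃ᵃⁱ[ℝ] E n

instance isomMulAction (n : ℕ) : MulAction (Isom n) (E n) where
  smul γ x := γ x
  one_smul _ := rfl
  mul_smul _ _ _ := rfl

theorem smul_def {n : ℕ} (γ : Isom n) (x : E n) : γ • x = γ x := rfl

/-- The translation `L_b : x ↦ x + b`. -/
def transl {n : ℕ} (b : E n) : Isom n := AffineIsometryEquiv.constVAdd ℝ (E n) b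

theorem transl_apply {n : ℕ} (b x : E n) : transl b x = x + b := by
  simp [transl, add_comm]

/-- The linear isometry `x ↦ B x` given by an orthogonal matrix `B`. -/
def rot {n : ℕ} (B : Matrix.orthogonalGroup (Fin n) ℝ) : Isom n :=
  (Unitary.linearIsometryEquiv
    ⟨Matrix.toEuclideanCLM (n := Fin n) (𝕜 := ℝ) B.1,
      Unitary.map_mem (Matrix.toEuclideanCLM (n := Fin n) (𝕜 := ℝ)) B.2⟩).toAffineIsometryEquiv

theorem rot_apply {n : ℕ} (B : Matrix.orthogonalGroup (Fin n) ℝ) (x : E n) :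
    rot B x = WithLp.toLp 2 (B.1.mulVec x.ofLp) := rfl

/-- The orbit space `Γ \ ℝⁿ` (with the quotient topology). -/
abbrev Orbifold {n : ℕ} (Γ : Subgroup (Isom n)) : Type :=
  Quotient (MulAction.orbitRel Γ (E n))

/-- The canonical projection `ℝⁿ → Γ \ ℝⁿ`. -/
def proj {n : ℕ} (Γ : Subgroup (Isom n)) (x : E n) : Orbifold Γ :=
  Quotient.mk (MulAction.orbitRel Γ (E n)) x

/-- `Γ` acts properly discontinuously on `ℝⁿ`. -/
def ActsProperlyDiscontinuously {n : ℕ} (Γ : Subgroup (Isom n)) : Prop :=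
  ∀ K : Set (E n), IsCompact K → {γ : Isom n | γ ∈ Γ ∧ (γ '' K ∩ K).Nonempty}.Finite

/-- `Γ` is crystallographic, i.e. acts properly discontinuously with compact quotient,
so that `Γ \ ℝⁿ` is a compact flat (good) orbifold. -/
def IsCrystallographic {n : ℕ} (Γ : Subgroup (Isom n)) : Prop :=
  ActsProperlyDiscontinuously Γ ∧ CompactSpace (Orbifold Γ)

/-! ### Isotropy -/

/-- The stabilizer `Γ_x` of a point `x` of `ℝⁿ`. -/
abbrev stab {n : ℕ} (Γ : Subgroup (Isom n)) (x : E n) : Subgroup Γ :=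
  MulAction.stabilizer Γ x

/-- The isotropy group of the point `q` of `Γ \ ℝⁿ` is isomorphic to `G`. -/
def HasIsotropy {n : ℕ} (Γ : Subgroup (Isom n)) (q : Orbifold Γ) (G : Type) [Group G] : Prop :=
  ∀ x : E n, proj Γ x = q → Nonempty (stab Γ x ≃* G)

/-- The isotropy order of a point of `Γ \ ℝⁿ`: the order of the stabilizer of any preimage. -/
def isotropyOrder {n : ℕ} (Γ : Subgroup (Isom n)) : Orbifold Γ → ℕ :=
  Quotient.lift (fun x : E n => Nat.card (stab Γ x)) fun _ _ h =>
    Nat.card_congr (MulAction.stabilizerEquivStabilizerOfOrbitRel h).toEquiv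

/-- The set of points of `Γ \ ℝⁿ` of maximal isotropy order. -/
def maxIsotropySet {n : ℕ} (Γ : Subgroup (Isom n)) : Set (Orbifold Γ) :=
  {q | ∀ q', isotropyOrder Γ q' ≤ isotropyOrder Γ q}

/-- `S ⊆ Γ \ ℝⁿ` consists of `N` disjoint simple closed geodesics of length `ℓ`: the `k`-th one
is the image of the straight line `r ↦ a k + r • u k`, which has unit speed, descends to a
closed curve of period `ℓ`, and is injective on a period. -/
def IsUnionOfCircles {n : ℕ} (Γ : Subgroup (Isom n)) (S : Set (Orbifold Γ)) (N : ℕ) (ℓ : ℝ) :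
    Prop :=
  ∃ a u : Fin N → E n, (∀ k, ‖u k‖ = 1) ∧
    (∀ k (r : ℝ), proj Γ (a k + (r + ℓ) • u k) = proj Γ (a k + r • u k)) ∧
    InjOn (fun p : Fin N × ℝ => proj Γ (a p.1 + p.2 • u p.1)) (univ ×ˢ Ico 0 ℓ) ∧
    (fun p : Fin N × ℝ => proj Γ (a p.1 + p.2 • u p.1)) '' (univ ×ˢ Ico 0 ℓ) = S

/-- `S ⊆ Γ \ ℝⁿ` consists of `N` disjoint open geodesic segments of length `ℓ`. -/
def IsUnionOfOpenSegments {n : ℕ} (Γ : Subgroup (Isom n)) (S : Set (Orbifold Γ)) (N : ℕ)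
    (ℓ : ℝ) : Prop :=
  ∃ a u : Fin N → E n, (∀ k, ‖u k‖ = 1) ∧
    InjOn (fun p : Fin N × ℝ => proj Γ (a p.1 + p.2 • u p.1)) (univ ×ˢ Ioo 0 ℓ) ∧
    (fun p : Fin N × ℝ => proj Γ (a p.1 + p.2 • u p.1)) '' (univ ×ˢ Ioo 0 ℓ) = S

/-! ### The Laplace spectrum on functions

Functions and forms are complex valued. The complex dimension of an eigenspace of complex valued
functions or forms is the real dimension of the corresponding space of real valued ones. -/

theorem two_le_infty : (2 : WithTop ℕ∞) ≤ ∞ := by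
  have h : ((2 : ℕ∞) : WithTop ℕ∞) ≤ ((⊤ : ℕ∞) : WithTop ℕ∞) := WithTop.coe_le_coe.2 le_top
  exact h

/-- The eigenspace `E_μ(Γ \ ℝⁿ)`: smooth `Γ`-invariant functions `f` with `-Δ f = μ f`. -/
def eigenfunctions {n : ℕ} (Γ : Subgroup (Isom n)) (μ : ℝ) : Submodule ℂ (E n → ℂ) where
  carrier := {f | ContDiff ℝ ∞ f ∧ (∀ γ ∈ Γ, ∀ x, f (γ x) = f x) ∧
    ∀ x, -(Laplacian.laplacian f) x = (μ : ℂ) * f x}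
  zero_mem' := by
    refine ⟨contDiff_const, fun _ _ _ => rfl, fun x => ?_⟩
    have h := InnerProductSpace.laplacian_const (E := E n) (F := ℂ) (c := 0)
    have h' : (Laplacian.laplacian (0 : E n → ℂ)) x = 0 := congrFun h x
    simp [h']
  add_mem' := by
    rintro f g ⟨hf, hf', hf''⟩ ⟨hg, hg', hg''⟩
    refine ⟨hf.add hg, fun γ hγ x => by simp [hf' γ hγ, hg' γ hγ], fun x => ?_⟩
    rw [ContDiffAt.laplacian_add (hf.of_le two_le_infty).contDiffAt
      (hg.of_le two_le_infty).contDiffAt, Pi.add_apply, mul_add, ← hf'', ← hg'']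
    ring
  smul_mem' := by
    rintro c f ⟨hf, hf', hf''⟩
    refine ⟨contDiff_const.smul hf, fun γ hγ x => by simp [hf' γ hγ], fun x => ?_⟩
    rw [InnerProductSpace.laplacian_smul c (hf.of_le two_le_infty).contDiffAt,
      Pi.smul_apply, smul_eq_mul, smul_eq_mul, mul_left_comm, ← hf'']
    ring

/-- `Γ₁ \ ℝⁿ` and `Γ₂ \ ℝⁿ` are isospectral on functions: every real number has the same
multiplicity as an eigenvalue of the Laplace operator on functions. -/
def IsospectralOnFunctions {n : ℕ} (Γ₁ Γ₂ : Subgroup (Isom n)) : Prop :=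
  ∀ μ : ℝ, Module.rank ℂ (eigenfunctions Γ₁ μ) = Module.rank ℂ (eigenfunctions Γ₂ μ)

/-! ### The Laplace spectrum on differential forms of positive degree -/

/-- Complex valued differential `k`-forms on `ℝⁿ`. -/
abbrev Form (n k : ℕ) : Type := E n → (E n) [⋀^Fin k]→L[ℝ] ℂ

/-- The operator `d*`, formal adjoint of the exterior derivative `d`:
`(d* w)(v₁, …, v_k) = -∑ i, (∂_i w)(e_i, v₁, …, v_k)`. -/
def codiff {n k : ℕ} (w : Form n (k + 1)) : Form n k := fun x =>
  -∑ i : Fin n, (fderiv ℝ w x (EuclideanSpace.single i 1)).curryLeft (EuclideanSpace.single i 1)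

/-- The Laplace operator `d d* + d* d` on `k`-forms, `k ≥ 1`. -/
def hodgeLaplacian {n k : ℕ} (w : Form n (k + 1)) : Form n (k + 1) := fun x =>
  extDeriv (codiff w) x + codiff (extDeriv w) x

/-- `γ^* w = w` for all `γ ∈ Γ`. -/
def FormInvariant {n k : ℕ} (Γ : Subgroup (Isom n)) (w : Form n k) : Prop :=
  ∀ γ ∈ Γ, ∀ x, (w (γ x)).compContinuousLinearMap (fderiv ℝ γ x) = w x

theorem contDiff_extDeriv {n k : ℕ} {w : Form n k} (h : ContDiff ℝ ∞ w) :
    ContDiff ℝ ∞ (extDeriv w) := by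
  have h1 : ContDiff ℝ ∞ (fderiv ℝ w) := h.fderiv_right (by simp)
  exact (ContinuousAlternatingMap.alternatizeUncurryFinCLM ℝ (E n) ℂ).contDiff.comp h1

theorem contDiff_codiff {n k : ℕ} {w : Form n (k + 1)} (h : ContDiff ℝ ∞ w) :
    ContDiff ℝ ∞ (codiff w) := by
  have h1 : ContDiff ℝ ∞ (fderiv ℝ w) := h.fderiv_right (by simp)
  refine ContDiff.neg (ContDiff.sum fun i _ => ?_)
  have h2 : ContDiff ℝ ∞ fun x => fderiv ℝ w x (EuclideanSpace.single i 1) :=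
    h1.clm_apply contDiff_const
  exact ((ContinuousAlternatingMap.curryLeftLI (𝕜 := ℝ) (E := E n) (F := ℂ)
    (n := k)).contDiff.comp h2).clm_apply contDiff_const

theorem codiff_add {n k : ℕ} {w η : Form n (k + 1)} (hw : ContDiff ℝ ∞ w)
    (hη : ContDiff ℝ ∞ η) : codiff (w + η) = codiff w + codiff η := by
  funext x
  have h1 := hw.differentiable (by simp) x
  have h2 := hη.differentiable (by simp) x
  simp only [codiff, Pi.add_apply]
  rw [fderiv_add h1 h2]
  simp [Finset.sum_add_distrib, add_comm]

theorem extDeriv_add' {n k : ℕ} {w η : Form n k} (hw : ContDiff ℝ ∞ w)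
    (hη : ContDiff ℝ ∞ η) : extDeriv (w + η) = extDeriv w + extDeriv η := by
  funext x
  exact extDeriv_add (hw.differentiable (by simp) x) (hη.differentiable (by simp) x)

theorem codiff_smul {n k : ℕ} (c : ℂ) {w : Form n (k + 1)} (hw : ContDiff ℝ ∞ w) :
    codiff (c • w) = c • codiff w := by
  funext x
  have h1 := hw.differentiable (by simp) x
  ext v
  simp only [codiff, Pi.smul_apply]
  rw [fderiv_const_smul h1]
  simp [Finset.mul_sum]

theorem extDeriv_smul' {n k : ℕ} (c : ℂ) {w : Form n k} (hw : ContDiff ℝ ∞ w) :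
    extDeriv (c • w) = c • extDeriv w := by
  funext x
  have h1 := hw.differentiable (by simp) x
  ext v
  simp only [extDeriv, Pi.smul_apply]
  rw [fderiv_const_smul h1]
  simp [ContinuousAlternatingMap.alternatizeUncurryFin_apply, Finset.mul_sum]

theorem hodgeLaplacian_add {n k : ℕ} {w η : Form n (k + 1)} (hw : ContDiff ℝ ∞ w)
    (hη : ContDiff ℝ ∞ η) :
    hodgeLaplacian (w + η) = hodgeLaplacian w + hodgeLaplacian η := by
  funext x
  simp only [hodgeLaplacian, Pi.add_apply]
  rw [codiff_add hw hη, extDeriv_add' (contDiff_codiff hw) (contDiff_codiff hη),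
    extDeriv_add' hw hη, codiff_add (contDiff_extDeriv hw) (contDiff_extDeriv hη)]
  simp only [Pi.add_apply]
  abel

theorem hodgeLaplacian_smul {n k : ℕ} (c : ℂ) {w : Form n (k + 1)} (hw : ContDiff ℝ ∞ w) :
    hodgeLaplacian (c • w) = c • hodgeLaplacian w := by
  funext x
  simp only [hodgeLaplacian, Pi.smul_apply]
  rw [codiff_smul c hw, extDeriv_smul' c (contDiff_codiff hw), extDeriv_smul' c hw,
    codiff_smul c (contDiff_extDeriv hw)]
  simp only [Pi.smul_apply, smul_add]

/-- Smooth `Γ`-invariant forms `w` of positive degree with `(d d* + d* d) w = μ w`. -/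
def eigenforms {n : ℕ} (k : ℕ) (Γ : Subgroup (Isom n)) (μ : ℝ) :
    Submodule ℂ (Form n (k + 1)) where
  carrier := {w | ContDiff ℝ ∞ w ∧ FormInvariant Γ w ∧
    ∀ x, hodgeLaplacian w x = (μ : ℂ) • w x}
  zero_mem' := by
    refine ⟨contDiff_const, fun _ _ _ => by ext; simp, fun x => ?_⟩
    have h := congrFun (hodgeLaplacian_smul (0 : ℂ) (w := (0 : Form n (k + 1))) contDiff_const) x
    have e : (0 : ℂ) • (0 : Form n (k + 1)) = 0 := by funext y; ext; simp
    have e' : (0 : ℂ) • hodgeLaplacian (0 : Form n (k + 1)) x = 0 := by ext; simp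
    rw [e, Pi.smul_apply, e'] at h
    rw [h]
    ext; simp
  add_mem' := by
    rintro f g ⟨hf, hf', hf''⟩ ⟨hg, hg', hg''⟩
    refine ⟨hf.add hg, fun γ hγ x => ?_, fun x => ?_⟩
    · rw [Pi.add_apply, Pi.add_apply, ← hf' γ hγ x, ← hg' γ hγ x]
      ext; simp
    · rw [hodgeLaplacian_add hf hg, Pi.add_apply, Pi.add_apply, smul_add, hf'', hg'']
  smul_mem' := by
    rintro c f ⟨hf, hf', hf''⟩
    refine ⟨contDiff_const.smul hf, fun γ hγ x => ?_, fun x => ?_⟩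
    · rw [Pi.smul_apply, Pi.smul_apply, ← hf' γ hγ x]
      ext; simp
    · rw [hodgeLaplacian_smul c hf, Pi.smul_apply, Pi.smul_apply, hf'', smul_comm]

/-- `Γ₁ \ ℝⁿ` and `Γ₂ \ ℝⁿ` are isospectral on `1`-forms. -/
def IsospectralOnOneForms {n : ℕ} (Γ₁ Γ₂ : Subgroup (Isom n)) : Prop :=
  ∀ μ : ℝ, Module.rank ℂ (eigenforms 0 Γ₁ μ) = Module.rank ℂ (eigenforms 0 Γ₂ μ)

/-! ### The two groups -/

/-- The lattice `Λ = 2ℤ × 2ℤ × 2ℤ`. -/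
def Lam : Set (E 3) := {v | ∀ i, ∃ m : ℤ, v i = 2 * m}

/-- The quarter rotation `τ` around the third axis. -/
def tau : Isom 3 := rot ⟨!![0, -1, 0; 1, 0, 0; 0, 0, 1], by
  rw [Matrix.mem_orthogonalGroup_iff]
  ext i j
  fin_cases i <;> fin_cases j <;> simp [Matrix.mul_apply, Fin.sum_univ_three]⟩

/-- The half-turn `χ₁`. -/
def chi1 : Isom 3 := rot ⟨!![1, 0, 0; 0, -1, 0; 0, 0, -1], by
  rw [Matrix.mem_orthogonalGroup_iff]
  ext i j
  fin_cases i <;> fin_cases j <;> simp [Matrix.mul_apply, Fin.sum_univ_three]⟩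

/-- The half-turn `χ₂`. -/
def chi2 : Isom 3 := rot ⟨!![-1, 0, 0; 0, 1, 0; 0, 0, -1], by
  rw [Matrix.mem_orthogonalGroup_iff]
  ext i j
  fin_cases i <;> fin_cases j <;> simp [Matrix.mul_apply, Fin.sum_univ_three]⟩

/-- The half-turn `χ₃`. -/
def chi3 : Isom 3 := rot ⟨!![-1, 0, 0; 0, -1, 0; 0, 0, 1], by
  rw [Matrix.mem_orthogonalGroup_iff]
  ext i j
  fin_cases i <;> fin_cases j <;> simp [Matrix.mul_apply, Fin.sum_univ_three]⟩

/-- `Γ₁` is generated by the translations `L_Λ` and `τ`. -/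
def Gam1 : Subgroup (Isom 3) := Subgroup.closure (transl '' Lam ∪ {tau})

/-- `Γ₂` is generated by the translations `L_Λ` and `χ₁, χ₂, χ₃`. -/
def Gam2 : Subgroup (Isom 3) := Subgroup.closure (transl '' Lam ∪ {chi1, chi2, chi3})

/-- The cyclic group `ℤ₄`. -/
abbrev Z4 : Type := Multiplicative (ZMod 4)

/-- The cyclic group `ℤ₂`. -/
abbrev Z2 : Type := Multiplicative (ZMod 2)

end FlatOrbifold

end

/-!
Both groups are split: `Γ = P ⋉ Λ` with a point group `P` of order four fixing the origin, cyclic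
for `Γ₁` and a Klein four-group for `Γ₂`.

*Isotropy.* Conjugation by `L_x` identifies the stabilizer of `x` with the group of those `ρ ∈ P`
for which `ρ x - x ∈ Λ` (`mem_range_stabLinearPart`). For each of the few elements of `P` this is a
condition on integrality and parity of the coordinates of `x`, which gives the isotropy groups
(`stab1_cases`, `stab2_cases`). Likewise `x` and `y` have the same image in `Γ \ ℝ³` exactly if
`y - ρ x ∈ Λ` for some `ρ ∈ P` (`proj_eq_proj_iff`), which gives the shape of the singular sets.

*Dimension.* The points of maximal isotropy of `Γ₂ \ ℝ³` form a finite set in a Hausdorff space. For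
`Γ₁`, an explicit invariant function embeds the set of points of maximal isotropy in the plane as a
pair of concentric circles. Circles about points of this pair meet it in finite sets, so it is at
most one-dimensional; it contains a nonconstant path, so it is not zero-dimensional.

*Functions.* By Green's formula on a period cube, an eigenfunction on the torus `Λ \ ℝ³` with
eigenvalue `μ` is orthogonal to all plane waves `exp (π i ⟨k, x⟩)` with `π² |k|² ≠ μ`, so it is a
finite combination of those with `π² |k|² = μ` (`exists_eq_sum_wave`). The point group permutes
these, and the trace of the projection onto the invariants shows that four times the multiplicity of
`μ` is the total number of plane waves fixed by the elements of `P` (`rank_eigenfunctions`). In both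
groups each of the three nontrivial elements is a rotation around a coordinate axis and fixes just
the plane waves with `k` on this axis; their number does not depend on the axis.

*`1`-forms.* The Laplace operator acts componentwise (`hodgeLaplacian_apply`), so the components of
harmonic forms are periodic harmonic functions, that is, constants. The form `dx₃` is invariant under
`Γ₁`, but no nonzero constant form is invariant under `Γ₂`: the multiplicities of the eigenvalue `0`
differ.
-/

noncomputable section

namespace FlatOrbifold

open Set
open scoped ContDiff

/-! ### Groups with a given point group and a given lattice of translations -/

theorem mul_apply {n : ℕ} (γ δ : Isom n) (x : E n) : (γ * δ) x = γ (δ x) := rfl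

theorem apply_add {n : ℕ} {ρ : Isom n} (h : ρ 0 = 0) (x y : E n) : ρ (x + y) = ρ x + ρ y := by
  have h1 : ∀ z, ρ z = ρ.linearIsometryEquiv z := fun z => by
    have := ρ.map_vadd 0 z
    simpa [h] using this
  rw [h1, h1, h1, map_add]

theorem norm_apply {n : ℕ} {ρ : Isom n} (h : ρ 0 = 0) (x : E n) : ‖ρ x‖ = ‖x‖ := by
  have := ρ.dist_map x 0
  rwa [h, dist_zero_right, dist_zero_right] at this

theorem transl_mul {n : ℕ} {ρ : Isom n} (h : ρ 0 = 0) (v : E n) :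
    transl (ρ v) * ρ = ρ * transl v := by
  ext1 x
  rw [mul_apply, mul_apply, transl_apply, transl_apply, apply_add h]

theorem transl_mul_transl {n : ℕ} (v w : E n) : transl v * transl w = transl (v + w) := by
  ext1 x
  rw [mul_apply, transl_apply, transl_apply, transl_apply, add_assoc, add_comm w]

theorem transl_zero {n : ℕ} : transl (0 : E n) = 1 := by
  ext1 x
  rw [transl_apply, add_zero]; rfl

theorem transl_inv {n : ℕ} (v : E n) : (transl v)⁻¹ = transl (-v) := by
  rw [inv_eq_iff_mul_eq_one, transl_mul_transl, add_neg_cancel, transl_zero]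

/-- `P` is a group of linear isometries (encoded as isometries fixing the origin) which preserves
the additive group `L`: the data of a split (symmorphic) group of isometries of `ℝⁿ`. -/
structure IsPointGroup {n : ℕ} (P : Subgroup (Isom n)) (L : AddSubgroup (E n)) : Prop where
  apply_zero : ∀ ρ ∈ P, ρ 0 = 0
  apply_mem : ∀ ρ ∈ P, ∀ v ∈ L, ρ v ∈ L

/-- The group `P ⋉ L` of all `x ↦ ρ (x + v)` with `ρ ∈ P` and `v ∈ L`. -/
def semidirect {n : ℕ} {P : Subgroup (Isom n)} {L : AddSubgroup (E n)} (h : IsPointGroup P L) :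
    Subgroup (Isom n) where
  carrier := {γ | ∃ ρ ∈ P, ∃ v ∈ L, γ = ρ * transl v}
  one_mem' := ⟨1, P.one_mem, 0, L.zero_mem, by rw [transl_zero, one_mul]⟩
  mul_mem' := by
    rintro _ _ ⟨ρ, hρ, v, hv, rfl⟩ ⟨σ, hσ, w, hw, rfl⟩
    refine ⟨ρ * σ, P.mul_mem hρ hσ, σ⁻¹ v + w,
      L.add_mem (h.apply_mem _ (P.inv_mem hσ) _ hv) hw, ?_⟩
    have := transl_mul (h.apply_zero σ hσ) (σ⁻¹ v)
    rw [← mul_apply, mul_inv_cancel] at this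
    change transl v * σ = _ at this
    rw [← transl_mul_transl, mul_assoc ρ (transl v), ← mul_assoc (transl v), this]
    simp only [mul_assoc]
  inv_mem' := by
    rintro _ ⟨ρ, hρ, v, hv, rfl⟩
    refine ⟨ρ⁻¹, P.inv_mem hρ, ρ (-v), h.apply_mem _ hρ _ (L.neg_mem hv), ?_⟩
    have := transl_mul (h.apply_zero _ (P.inv_mem hρ)) (ρ (-v))
    rw [← mul_apply, inv_mul_cancel] at this
    rw [mul_inv_rev, transl_inv, ← this]
    rfl

section

variable {n : ℕ} {P : Subgroup (Isom n)} {L : AddSubgroup (E n)} (h : IsPointGroup P L)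

theorem mem_semidirect {γ : Isom n} :
    γ ∈ semidirect h ↔ ∃ ρ ∈ P, ∃ v ∈ L, γ = ρ * transl v := Iff.rfl

/-- Two points lie in the same orbit exactly if they agree modulo `L` up to an element of the
point group. -/
theorem proj_eq_proj_iff {x y : E n} :
    proj (semidirect h) x = proj (semidirect h) y ↔ ∃ ρ ∈ P, y - ρ x ∈ L := by
  rw [eq_comm, proj, proj, Quotient.eq, MulAction.orbitRel_apply, MulAction.mem_orbit_iff]
  constructor
  · rintro ⟨⟨_, ρ, hρ, v, hv, rfl⟩, rfl⟩
    refine ⟨ρ, hρ, ?_⟩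
    change ρ (transl v x) - ρ x ∈ L
    rw [transl_apply, apply_add (h.apply_zero ρ hρ), add_sub_cancel_left]
    exact h.apply_mem ρ hρ v hv
  · rintro ⟨ρ, hρ, hv⟩
    refine ⟨⟨ρ * transl (ρ⁻¹ (y - ρ x)), ρ, hρ, _, h.apply_mem _ (P.inv_mem hρ) _ hv, rfl⟩, ?_⟩
    change ρ (transl _ x) = y
    rw [transl_apply, apply_add (h.apply_zero ρ hρ), ← mul_apply, mul_inv_cancel]
    exact add_sub_cancel _ _

theorem actsProperlyDiscontinuously_semidirect (hP : (P : Set (Isom n)).Finite)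
    (hL : ∀ R : ℝ, {v | v ∈ L ∧ ‖v‖ ≤ R}.Finite) :
    ActsProperlyDiscontinuously (semidirect h) := by
  intro K hK
  obtain ⟨R, hR⟩ := hK.isBounded.exists_norm_le
  refine ((hP.prod (hL (R + R))).image fun p : Isom n × E n => p.1 * transl p.2).subset ?_
  rintro _ ⟨⟨ρ, hρ, v, hv, rfl⟩, _, ⟨x, hx, rfl⟩, hx'⟩
  refine ⟨(ρ, v), ⟨hρ, hv, ?_⟩, rfl⟩
  have h1 := hR _ hx'
  rw [mul_apply, norm_apply (h.apply_zero ρ hρ), transl_apply] at h1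
  calc ‖v‖ = ‖(x + v) - x‖ := by rw [add_sub_cancel_left]
    _ ≤ ‖x + v‖ + ‖x‖ := norm_sub_le _ _
    _ ≤ R + R := add_le_add h1 (hR x hx)

/-- The conjugation `γ ↦ L_{-x} γ L_x` as a homomorphism on the stabilizer of `x`: it takes an
isometry fixing `x` to its linear part. -/
def stabLinearPart (Γ : Subgroup (Isom n)) (x : E n) : stab Γ x →* Isom n :=
  (MulAut.conj (transl (-x))).toMonoidHom.comp (Γ.subtype.comp (stab Γ x).subtype)

theorem stabLinearPart_injective (Γ : Subgroup (Isom n)) (x : E n) :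
    Function.Injective (stabLinearPart Γ x) :=
  (MulAut.conj (transl (-x))).injective.comp
    (Subtype.val_injective.comp Subtype.val_injective)

/-- The linear parts of the isometries in `P ⋉ L` that fix `x` are the elements of `P` that move `x`
by an element of `L`. -/
theorem mem_range_stabLinearPart {x : E n} {ρ : Isom n} :
    ρ ∈ (stabLinearPart (semidirect h) x).range ↔ ρ ∈ P ∧ ρ x - x ∈ L := by
  constructor
  · rintro ⟨⟨⟨_, ρ, hρ, v, hv, rfl⟩, hx⟩, rfl⟩
    have hx' : ρ (x + v) = x := by rw [← transl_apply]; exact hx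
    have e : stabLinearPart (semidirect h) x
        ⟨⟨ρ * transl v, ρ, hρ, v, hv, rfl⟩, hx⟩ = ρ := by
      change transl (-x) * (ρ * transl v) * (transl (-x))⁻¹ = ρ
      ext1 y
      rw [transl_inv, neg_neg, mul_apply, mul_apply, mul_apply, transl_apply, transl_apply,
        transl_apply, show y + x + v = y + (x + v) by abel, apply_add (h.apply_zero ρ hρ), hx',
        add_neg_cancel_right]
    rw [e]
    refine ⟨hρ, ?_⟩
    rw [apply_add (h.apply_zero ρ hρ)] at hx'
    have : ρ x - x = -ρ v := eq_neg_of_add_eq_zero_left (by rw [sub_add_eq_add_sub, hx', sub_self])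
    rw [this]
    exact L.neg_mem (h.apply_mem ρ hρ v hv)
  · rintro ⟨hρ, hv⟩
    have h0 := h.apply_zero ρ hρ
    set v := ρ⁻¹ (-(ρ x - x)) with hvdef
    have hρv : ρ v = x - ρ x := by
      rw [hvdef, ← mul_apply, mul_inv_cancel, neg_sub]; rfl
    refine ⟨⟨⟨ρ * transl v, ρ, hρ, v, h.apply_mem _ (P.inv_mem hρ) _ (L.neg_mem hv), rfl⟩, ?_⟩, ?_⟩
    · change ρ (transl v x) = x
      rw [transl_apply, apply_add h0, hρv, add_sub_cancel]
    · change transl (-x) * (ρ * transl v) * (transl (-x))⁻¹ = ρ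
      ext1 y
      rw [transl_inv, neg_neg, mul_apply, mul_apply, mul_apply, transl_apply, transl_apply,
        transl_apply, apply_add h0, apply_add h0, hρv]
      abel

end

theorem t2Space_orbifold {n : ℕ} {Γ : Subgroup (Isom n)} (h : ActsProperlyDiscontinuously Γ) :
    T2Space (Orbifold Γ) := by
  have : ContinuousConstSMul Γ (E n) := ⟨fun γ => γ.1.continuous⟩
  have : ProperlyDiscontinuousSMul Γ (E n) := ⟨fun {K M} hK hM => by
    refine Set.Finite.of_finite_image ((h _ (hK.union hM)).subset ?_)
      (Subtype.val_injective.injOn (s := {γ : Γ | ((fun x => γ • x) '' K ∩ M).Nonempty}))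
    rintro _ ⟨γ, ⟨_, ⟨x, hx, rfl⟩, hx'⟩, rfl⟩
    exact ⟨γ.2, _, ⟨x, Or.inl hx, rfl⟩, Or.inr hx'⟩⟩
  exact t2Space_of_properlyDiscontinuousSMul_of_t2Space

theorem continuous_proj {n : ℕ} (Γ : Subgroup (Isom n)) : Continuous (proj Γ) :=
  continuous_quot_mk

theorem proj_surjective {n : ℕ} (Γ : Subgroup (Isom n)) : Function.Surjective (proj Γ) :=
  Quotient.mk_surjective

/-- The isotropy group of a point is computed at any one of its preimages. -/
theorem hasIsotropy_proj_iff {n : ℕ} {Γ : Subgroup (Isom n)} {x : E n} {G : Type} [Group G] :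
    HasIsotropy Γ (proj Γ x) G ↔ Nonempty (stab Γ x ≃* G) := by
  refine ⟨fun h => h x rfl, fun ⟨e⟩ y hy => ⟨?_⟩⟩
  exact (MulAction.stabilizerEquivStabilizerOfOrbitRel (Quotient.exact hy)).trans e

/-! ### The two groups -/

/-- The lattice `2ℤ × 2ℤ × 2ℤ` as an additive group. -/
def lattice : AddSubgroup (E 3) where
  carrier := Lam
  zero_mem' := fun i => ⟨0, by simp⟩
  add_mem' := fun {v w} hv hw i => by
    obtain ⟨a, ha⟩ := hv i
    obtain ⟨b, hb⟩ := hw i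
    exact ⟨a + b, by simp [ha, hb]; ring⟩
  neg_mem' := fun {v} hv i => by
    obtain ⟨a, ha⟩ := hv i
    exact ⟨-a, by simp [ha]⟩

theorem mem_lattice {v : E 3} : v ∈ lattice ↔ ∀ i, ∃ m : ℤ, v i = 2 * m := Iff.rfl

theorem finite_lattice_norm_le (R : ℝ) : {v | v ∈ lattice ∧ ‖v‖ ≤ R}.Finite := by
  refine ((Set.finite_Icc (fun _ : Fin 3 => -⌈R⌉) (fun _ => ⌈R⌉)).image
    fun m => WithLp.toLp 2 fun i => (2 * m i : ℝ)).subset ?_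
  rintro v ⟨hv, hR⟩
  choose m hm using hv
  have hb : ∀ i, |(m i : ℝ)| ≤ ⌈R⌉ := fun i => by
    have h1 := (PiLp.norm_apply_le v i).trans hR
    rw [hm i, Real.norm_eq_abs, abs_mul, abs_two] at h1
    linarith [Int.le_ceil R, abs_nonneg (m i : ℝ)]
  refine ⟨m, ⟨fun i => ?_, fun i => ?_⟩, ?_⟩
  · exact_mod_cast (abs_le.1 (hb i)).1
  · exact_mod_cast (abs_le.1 (hb i)).2
  · ext i; exact (hm i).symm

theorem compactSpace_orbifold {P : Subgroup (Isom 3)} (h : IsPointGroup P lattice) :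
    CompactSpace (Orbifold (semidirect h)) := by
  have hK : IsCompact (WithLp.toLp 2 '' Icc (0 : Fin 3 → ℝ) 2 : Set (E 3)) :=
    isCompact_Icc.image (PiLp.continuous_toLp 2 _)
  refine ⟨?_⟩
  convert hK.image (continuous_proj (semidirect h))
  refine (eq_univ_of_forall fun q => ?_).symm
  obtain ⟨x, rfl⟩ := proj_surjective _ q
  refine ⟨_, ⟨fun i => x i - 2 * ⌊x i / 2⌋, ⟨fun i => ?_, fun i => ?_⟩, rfl⟩, ?_⟩
  · have := Int.floor_le (x i / 2)
    simp only [Pi.zero_apply]; linarith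
  · have := Int.lt_floor_add_one (x i / 2)
    simp only [Pi.ofNat_apply]; linarith
  · refine (proj_eq_proj_iff h).2 ⟨1, P.one_mem, fun i => ⟨⌊x i / 2⌋, ?_⟩⟩
    simp

theorem isCrystallographic_semidirect {P : Subgroup (Isom 3)} (h : IsPointGroup P lattice)
    (hP : (P : Set (Isom 3)).Finite) : IsCrystallographic (semidirect h) :=
  ⟨actsProperlyDiscontinuously_semidirect h hP finite_lattice_norm_le, compactSpace_orbifold h⟩

@[simp] theorem tau_apply_zero (x : E 3) : tau x 0 = -x 1 := by
  simp [tau, rot_apply, dotProduct, Fin.sum_univ_three]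
@[simp] theorem tau_apply_one (x : E 3) : tau x 1 = x 0 := by
  simp [tau, rot_apply, dotProduct, Fin.sum_univ_three]
@[simp] theorem tau_apply_two (x : E 3) : tau x 2 = x 2 := by
  simp [tau, rot_apply, dotProduct, Fin.sum_univ_three]
@[simp] theorem chi1_apply_zero (x : E 3) : chi1 x 0 = x 0 := by
  simp [chi1, rot_apply, dotProduct, Fin.sum_univ_three]
@[simp] theorem chi1_apply_one (x : E 3) : chi1 x 1 = -x 1 := by
  simp [chi1, rot_apply, dotProduct, Fin.sum_univ_three]
@[simp] theorem chi1_apply_two (x : E 3) : chi1 x 2 = -x 2 := by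
  simp [chi1, rot_apply, dotProduct, Fin.sum_univ_three]
@[simp] theorem chi2_apply_zero (x : E 3) : chi2 x 0 = -x 0 := by
  simp [chi2, rot_apply, dotProduct, Fin.sum_univ_three]
@[simp] theorem chi2_apply_one (x : E 3) : chi2 x 1 = x 1 := by
  simp [chi2, rot_apply, dotProduct, Fin.sum_univ_three]
@[simp] theorem chi2_apply_two (x : E 3) : chi2 x 2 = -x 2 := by
  simp [chi2, rot_apply, dotProduct, Fin.sum_univ_three]
@[simp] theorem chi3_apply_zero (x : E 3) : chi3 x 0 = -x 0 := by
  simp [chi3, rot_apply, dotProduct, Fin.sum_univ_three]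
@[simp] theorem chi3_apply_one (x : E 3) : chi3 x 1 = -x 1 := by
  simp [chi3, rot_apply, dotProduct, Fin.sum_univ_three]
@[simp] theorem chi3_apply_two (x : E 3) : chi3 x 2 = x 2 := by
  simp [chi3, rot_apply, dotProduct, Fin.sum_univ_three]

theorem isom_ext {ρ σ : Isom 3} (h0 : ∀ x, ρ x 0 = σ x 0) (h1 : ∀ x, ρ x 1 = σ x 1)
    (h2 : ∀ x, ρ x 2 = σ x 2) : ρ = σ := by
  ext x i
  fin_cases i
  exacts [h0 x, h1 x, h2 x]

theorem one_apply {n : ℕ} (x : E n) : (1 : Isom n) x = x := rfl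

theorem tau_sq : tau ^ 2 = chi3 :=
  isom_ext (by simp [pow_succ, mul_apply]) (by simp [pow_succ, mul_apply])
    (by simp [pow_succ, mul_apply])

theorem tau_pow_four : tau ^ 4 = 1 :=
  isom_ext (by simp [pow_succ, mul_apply, one_apply]) (by simp [pow_succ, mul_apply, one_apply])
    (by simp [pow_succ, mul_apply, one_apply])

theorem chi3_ne_one : chi3 ≠ 1 := fun h => by
  have := congrArg (fun γ : Isom 3 => γ (EuclideanSpace.single 0 1) 0) h
  norm_num [one_apply] at this

theorem orderOf_tau : orderOf tau = 4 :=
  orderOf_eq_prime_pow (p := 2) (n := 1) (by simpa [tau_sq] using chi3_ne_one) tau_pow_four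

/-- The point group of `Γ₁`. -/
abbrev pointGroup1 : Subgroup (Isom 3) := Subgroup.zpowers tau

theorem mem_pointGroup1 {ρ : Isom 3} : ρ ∈ pointGroup1 ↔ ∃ j < 4, ρ = tau ^ j := by
  classical
  have : IsOfFinOrder tau := orderOf_pos_iff.1 (by rw [orderOf_tau]; norm_num)
  rw [← this.mem_powers_iff_mem_zpowers, this.mem_powers_iff_mem_range_orderOf, orderOf_tau]
  simp [eq_comm]

/-- The four rotations making up the point group of `Γ₁`. -/
theorem mem_pointGroup1' {ρ : Isom 3} :
    ρ ∈ pointGroup1 ↔ ρ = 1 ∨ ρ = tau ∨ ρ = chi3 ∨ ρ = chi3 * tau := by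
  rw [mem_pointGroup1, ← tau_sq]
  constructor
  · rintro ⟨j, hj, rfl⟩
    interval_cases j <;> simp [pow_succ]
  · rintro (rfl | rfl | rfl | rfl)
    exacts [⟨0, by simp⟩, ⟨1, by simp⟩, ⟨2, by simp⟩, ⟨3, by simp [pow_succ]⟩]

theorem chi_mul :
    chi1 * chi1 = 1 ∧ chi2 * chi2 = 1 ∧ chi3 * chi3 = 1 ∧ chi1 * chi2 = chi3 ∧
    chi2 * chi1 = chi3 ∧ chi1 * chi3 = chi2 ∧ chi3 * chi1 = chi2 ∧ chi2 * chi3 = chi1 ∧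
    chi3 * chi2 = chi1 := by
  refine ⟨?_, ?_, ?_, ?_, ?_, ?_, ?_, ?_, ?_⟩ <;>
  exact isom_ext (by simp [mul_apply, one_apply]) (by simp [mul_apply, one_apply])
    (by simp [mul_apply, one_apply])

/-- The point group of `Γ₂`. -/
def pointGroup2 : Subgroup (Isom 3) where
  carrier := {1, chi1, chi2, chi3}
  one_mem' := by simp
  mul_mem' := by
    obtain ⟨h1, h2, h3, h4, h5, h6, h7, h8, h9⟩ := chi_mul
    rintro _ _ (rfl | rfl | rfl | rfl) (rfl | rfl | rfl | rfl) <;>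
    simp [h1, h2, h3, h4, h5, h6, h7, h8, h9]
  inv_mem' := by
    obtain ⟨h1, h2, h3, -⟩ := chi_mul
    rintro _ (rfl | rfl | rfl | rfl) <;>
    simp [inv_eq_of_mul_eq_one_left h1, inv_eq_of_mul_eq_one_left h2,
      inv_eq_of_mul_eq_one_left h3]

theorem mem_pointGroup2 {ρ : Isom 3} :
    ρ ∈ pointGroup2 ↔ ρ = 1 ∨ ρ = chi1 ∨ ρ = chi2 ∨ ρ = chi3 := Iff.rfl

theorem fin3_ext {x y : E 3} (h0 : x 0 = y 0) (h1 : x 1 = y 1) (h2 : x 2 = y 2) : x = y := by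
  ext i; fin_cases i
  exacts [h0, h1, h2]

/-- A real number is an even integer. -/
def IsEvenInt (t : ℝ) : Prop := ∃ m : ℤ, t = 2 * m

theorem mem_lattice' {v : E 3} :
    v ∈ lattice ↔ IsEvenInt (v 0) ∧ IsEvenInt (v 1) ∧ IsEvenInt (v 2) := by
  rw [mem_lattice, Fin.forall_fin_succ, Fin.forall_fin_two]
  rfl

@[simp] theorem isEvenInt_neg {t : ℝ} : IsEvenInt (-t) ↔ IsEvenInt t := by
  constructor <;> rintro ⟨m, hm⟩
  · exact ⟨-m, by push_cast; linarith⟩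
  · exact ⟨-m, by push_cast; linarith⟩

@[simp] theorem isEvenInt_zero : IsEvenInt 0 := ⟨0, by simp⟩

theorem isPointGroup1 : IsPointGroup pointGroup1 lattice where
  apply_zero ρ hρ := by
    rcases mem_pointGroup1'.1 hρ with rfl | rfl | rfl | rfl <;>
    exact fin3_ext (by simp [mul_apply, one_apply]) (by simp [mul_apply, one_apply])
      (by simp [mul_apply, one_apply])
  apply_mem ρ hρ v hv := by
    rw [mem_lattice'] at hv ⊢
    rcases mem_pointGroup1'.1 hρ with rfl | rfl | rfl | rfl <;>
    simp [mul_apply, one_apply, hv]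

theorem isPointGroup2 : IsPointGroup pointGroup2 lattice where
  apply_zero ρ hρ := by
    rcases mem_pointGroup2.1 hρ with rfl | rfl | rfl | rfl <;>
    exact fin3_ext (by simp [one_apply]) (by simp [one_apply]) (by simp [one_apply])
  apply_mem ρ hρ v hv := by
    rw [mem_lattice'] at hv ⊢
    rcases mem_pointGroup2.1 hρ with rfl | rfl | rfl | rfl <;> simp [one_apply, hv]

theorem gam1_eq : Gam1 = semidirect isPointGroup1 := by
  refine le_antisymm ((Subgroup.closure_le _).2 ?_) ?_
  · rintro _ (⟨v, hv, rfl⟩ | rfl)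
    · exact ⟨1, Subgroup.one_mem _, v, hv, (one_mul _).symm⟩
    · exact ⟨tau, Subgroup.mem_zpowers _, 0, lattice.zero_mem, by rw [transl_zero, mul_one]⟩
  · rintro _ ⟨_, ⟨k, rfl⟩, v, hv, rfl⟩
    exact Gam1.mul_mem (Gam1.zpow_mem (Subgroup.subset_closure (Or.inr rfl)) k)
      (Subgroup.subset_closure (Or.inl ⟨v, hv, rfl⟩))

theorem gam2_eq : Gam2 = semidirect isPointGroup2 := by
  refine le_antisymm ((Subgroup.closure_le _).2 ?_) ?_
  · rintro _ (⟨v, hv, rfl⟩ | hρ)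
    · exact ⟨1, Subgroup.one_mem _, v, hv, (one_mul _).symm⟩
    · exact ⟨_, Or.inr hρ, 0, lattice.zero_mem, by rw [transl_zero, mul_one]⟩
  · rintro _ ⟨ρ, hρ, v, hv, rfl⟩
    refine Gam2.mul_mem ?_ (Subgroup.subset_closure (Or.inl ⟨v, hv, rfl⟩))
    rcases hρ with rfl | hρ
    · exact Gam2.one_mem
    · exact Subgroup.subset_closure (Or.inr hρ)

theorem mem_gam1_iff (γ : Isom 3) :
    γ ∈ Gam1 ↔ ∃ j : ℕ, j < 4 ∧ ∃ v ∈ Lam, γ = tau ^ j * transl v := by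
  rw [gam1_eq, mem_semidirect]
  constructor
  · rintro ⟨ρ, hρ, v, hv, rfl⟩
    obtain ⟨j, hj, rfl⟩ := mem_pointGroup1.1 hρ
    exact ⟨j, hj, v, hv, rfl⟩
  · rintro ⟨j, hj, v, hv, rfl⟩
    exact ⟨_, mem_pointGroup1.2 ⟨j, hj, rfl⟩, v, hv, rfl⟩

theorem mem_gam2_iff (γ : Isom 3) :
    γ ∈ Gam2 ↔ ∃ ρ ∈ ({1, chi1, chi2, chi3} : Set (Isom 3)), ∃ v ∈ Lam, γ = ρ * transl v := by
  rw [gam2_eq]; rfl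

theorem isCrystallographic_gam1 : IsCrystallographic Gam1 := by
  rw [gam1_eq]
  refine isCrystallographic_semidirect _ ((Set.toFinite {1, tau, chi3, chi3 * tau}).subset ?_)
  exact fun ρ hρ => mem_pointGroup1'.1 hρ

theorem isCrystallographic_gam2 : IsCrystallographic Gam2 := by
  rw [gam2_eq]
  exact isCrystallographic_semidirect _ (Set.toFinite {1, chi1, chi2, chi3})

instance : T2Space (Orbifold Gam1) := t2Space_orbifold isCrystallographic_gam1.1
instance : T2Space (Orbifold Gam2) := t2Space_orbifold isCrystallographic_gam2.1

/-! ### Isotropy groups -/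

/-- A real number is an integer. -/
def IsInt (t : ℝ) : Prop := ∃ m : ℤ, t = m

@[simp] theorem isEvenInt_neg_sub_self {t : ℝ} : IsEvenInt (-t - t) ↔ IsInt t := by
  constructor <;> rintro ⟨m, hm⟩ <;> exact ⟨-m, by push_cast; linarith⟩

theorem isEvenInt_intCast {m : ℤ} : IsEvenInt m ↔ Even m := by
  rw [even_iff_exists_two_mul]
  exact exists_congr fun k => by norm_cast

/-- The stabilizer of `x` is isomorphic to the group of linear parts of its elements. -/
def stabEquivRange {n : ℕ} (Γ : Subgroup (Isom n)) (x : E n) :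
    stab Γ x ≃* (stabLinearPart Γ x).range :=
  MonoidHom.ofInjective (stabLinearPart_injective Γ x)

theorem nonempty_zpowers_mulEquiv {G : Type*} [Group G] (g : G) {m : ℕ} (h : orderOf g = m) :
    Nonempty (Subgroup.zpowers g ≃* Multiplicative (ZMod m)) :=
  ⟨mulEquivOfCyclicCardEq (by
    rw [Nat.card_zpowers, h]; exact (Nat.card_zmod m).symm)⟩

theorem card_eq_one_of_range_eq_bot {n : ℕ} {Γ : Subgroup (Isom n)} {x : E n}
    (h : (stabLinearPart Γ x).range = ⊥) : Nat.card (stab Γ x) = 1 := by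
  rw [Nat.card_congr (stabEquivRange Γ x).toEquiv, h, Subgroup.card_bot]

theorem nonempty_stab_mulEquiv {n : ℕ} {Γ : Subgroup (Isom n)} {x : E n} {ρ : Isom n} {m : ℕ}
    (h : (stabLinearPart Γ x).range = Subgroup.zpowers ρ) (hρ : orderOf ρ = m) :
    Nonempty (stab Γ x ≃* Multiplicative (ZMod m)) := by
  obtain ⟨e⟩ := nonempty_zpowers_mulEquiv ρ hρ
  exact ⟨((stabEquivRange Γ x).trans (MulEquiv.subgroupCongr h)).trans e⟩

theorem mem_zpowers_of_mul_self {G : Type*} [Group G] {g x : G} (hg : g * g = 1) :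
    x ∈ Subgroup.zpowers g ↔ x = 1 ∨ x = g := by
  constructor
  · rintro ⟨k, rfl⟩
    change g ^ k = 1 ∨ g ^ k = g
    rcases Int.even_or_odd' k with ⟨m, rfl | rfl⟩
    · left; rw [zpow_mul, zpow_two, hg, one_zpow]
    · right; rw [zpow_add, zpow_mul, zpow_two, hg, one_zpow, zpow_one, one_mul]
  · rintro (rfl | rfl)
    exacts [Subgroup.one_mem _, Subgroup.mem_zpowers _]

theorem mem_range1 {x : E 3} {ρ : Isom 3} :
    ρ ∈ (stabLinearPart Gam1 x).range ↔ ρ ∈ pointGroup1 ∧ ρ x - x ∈ lattice := by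
  rw [gam1_eq]; exact mem_range_stabLinearPart _

theorem mem_range2 {x : E 3} {ρ : Isom 3} :
    ρ ∈ (stabLinearPart Gam2 x).range ↔ ρ ∈ pointGroup2 ∧ ρ x - x ∈ lattice := by
  rw [gam2_eq]; exact mem_range_stabLinearPart _

theorem proj1_eq_iff {x y : E 3} :
    proj Gam1 x = proj Gam1 y ↔ ∃ ρ ∈ pointGroup1, y - ρ x ∈ lattice := by
  rw [gam1_eq]; exact proj_eq_proj_iff _

theorem proj2_eq_iff {x y : E 3} :
    proj Gam2 x = proj Gam2 y ↔ ∃ ρ ∈ pointGroup2, y - ρ x ∈ lattice := by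
  rw [gam2_eq]; exact proj_eq_proj_iff _

theorem tau_sub_mem {x : E 3} :
    tau x - x ∈ lattice ↔ ∃ m k : ℤ, x 0 = m ∧ x 1 = k ∧ Even (m + k) := by
  simp only [mem_lattice', PiLp.sub_apply, tau_apply_zero, tau_apply_one, tau_apply_two, sub_self,
    isEvenInt_zero, and_true]
  constructor
  · rintro ⟨⟨a, ha⟩, ⟨b, hb⟩⟩
    refine ⟨b - a, -a - b, by push_cast; linarith, by push_cast; linarith, -a, by ring⟩
  · rintro ⟨m, k, hm, hk, c, hc⟩
    have hc' : (m + k : ℝ) = c + c := by exact_mod_cast hc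
    exact ⟨⟨-c, by push_cast; linarith⟩, ⟨m - c, by push_cast; linarith⟩⟩

theorem chi3_sub_mem {x : E 3} : chi3 x - x ∈ lattice ↔ IsInt (x 0) ∧ IsInt (x 1) := by
  simp [mem_lattice']

theorem chi2_sub_mem {x : E 3} : chi2 x - x ∈ lattice ↔ IsInt (x 0) ∧ IsInt (x 2) := by
  simp [mem_lattice']

theorem chi1_sub_mem {x : E 3} : chi1 x - x ∈ lattice ↔ IsInt (x 1) ∧ IsInt (x 2) := by
  simp [mem_lattice']

theorem chi3_mul_tau : chi3 * tau = tau⁻¹ := by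
  rw [eq_inv_iff_mul_eq_one, mul_assoc, ← tau_sq, ← pow_two, ← pow_add, tau_pow_four]

theorem nonempty_stab1_mulEquiv_Z4 {x : E 3} {m k : ℤ} (h0 : x 0 = m) (h1 : x 1 = k)
    (h : Even (m + k)) : Nonempty (stab Gam1 x ≃* Z4) := by
  have ht : tau ∈ (stabLinearPart Gam1 x).range :=
    mem_range1.2 ⟨Subgroup.mem_zpowers _, tau_sub_mem.2 ⟨m, k, h0, h1, h⟩⟩
  refine nonempty_stab_mulEquiv (le_antisymm ?_ ((Subgroup.zpowers_le).2 ht)) orderOf_tau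
  exact fun ρ hρ => (mem_range1.1 hρ).1

theorem mem_range1_of_tau_notMem {x : E 3} (ht : tau x - x ∉ lattice) {ρ : Isom 3} :
    ρ ∈ (stabLinearPart Gam1 x).range ↔
      ρ = 1 ∨ ρ = chi3 ∧ IsInt (x 0) ∧ IsInt (x 1) := by
  have ht' : tau ∉ (stabLinearPart Gam1 x).range := fun h => ht (mem_range1.1 h).2
  constructor
  · intro h
    rcases mem_pointGroup1'.1 (mem_range1.1 h).1 with rfl | rfl | rfl | rfl
    · exact Or.inl rfl
    · exact absurd h ht'
    · exact Or.inr ⟨rfl, chi3_sub_mem.1 (mem_range1.1 h).2⟩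
    · rw [chi3_mul_tau, Subgroup.inv_mem_iff] at h
      exact absurd h ht'
  · rintro (rfl | ⟨rfl, h⟩)
    · exact Subgroup.one_mem _
    · exact mem_range1.2 ⟨mem_pointGroup1'.2 (by simp), chi3_sub_mem.2 h⟩

theorem orderOf_chi3 : orderOf chi3 = 2 :=
  orderOf_eq_prime (by rw [pow_two, chi_mul.2.2.1]) chi3_ne_one

theorem nonempty_stab1_mulEquiv_Z2 {x : E 3} {m k : ℤ} (h0 : x 0 = m) (h1 : x 1 = k)
    (h : Odd (m + k)) : Nonempty (stab Gam1 x ≃* Z2) := by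
  have ht : tau x - x ∉ lattice := by
    rintro h'
    obtain ⟨m', k', h0', h1', h'⟩ := tau_sub_mem.1 h'
    rw [h0] at h0'; rw [h1] at h1'
    rw [Int.cast_injective h0', Int.cast_injective h1'] at h
    exact Int.not_even_iff_odd.2 h h'
  refine nonempty_stab_mulEquiv (ρ := chi3) ?_ orderOf_chi3
  ext ρ
  rw [mem_range1_of_tau_notMem ht, mem_zpowers_of_mul_self chi_mul.2.2.1]
  simp [show IsInt (x 0) from ⟨m, h0⟩, show IsInt (x 1) from ⟨k, h1⟩]

theorem card_stab1_eq_one {x : E 3} (h : ¬ (IsInt (x 0) ∧ IsInt (x 1))) :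
    Nat.card (stab Gam1 x) = 1 := by
  have ht : tau x - x ∉ lattice := fun h' => by
    obtain ⟨m, k, h0, h1, -⟩ := tau_sub_mem.1 h'
    exact h ⟨⟨m, h0⟩, ⟨k, h1⟩⟩
  refine card_eq_one_of_range_eq_bot ?_
  ext ρ
  simp [mem_range1_of_tau_notMem ht, h]

theorem card_of_mulEquiv_Z4 {G : Type*} [Group G] (h : Nonempty (G ≃* Z4)) : Nat.card G = 4 := by
  rw [Nat.card_congr h.some.toEquiv]; simp

theorem card_of_mulEquiv_Z2 {G : Type*} [Group G] (h : Nonempty (G ≃* Z2)) : Nat.card G = 2 := by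
  rw [Nat.card_congr h.some.toEquiv]; simp

theorem card_of_mulEquiv_Z2_prod_Z2 {G : Type*} [Group G] (h : Nonempty (G ≃* Z2 × Z2)) :
    Nat.card G = 4 := by
  rw [Nat.card_congr h.some.toEquiv]; simp

theorem isotropyOrder_proj {n : ℕ} (Γ : Subgroup (Isom n)) (x : E n) :
    isotropyOrder Γ (proj Γ x) = Nat.card (stab Γ x) := rfl

/-- The three kinds of points of `Γ₁ \ ℝ³`. -/
theorem stab1_cases (x : E 3) :
    ((∃ m k : ℤ, x 0 = m ∧ x 1 = k ∧ Even (m + k)) ∧ Nonempty (stab Gam1 x ≃* Z4)) ∨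
    ((∃ m k : ℤ, x 0 = m ∧ x 1 = k ∧ Odd (m + k)) ∧ Nonempty (stab Gam1 x ≃* Z2)) ∨
    (¬ (IsInt (x 0) ∧ IsInt (x 1)) ∧ Nat.card (stab Gam1 x) = 1) := by
  by_cases h : IsInt (x 0) ∧ IsInt (x 1)
  · obtain ⟨⟨m, h0⟩, ⟨k, h1⟩⟩ := h
    rcases Int.even_or_odd (m + k) with h | h
    · exact Or.inl ⟨⟨m, k, h0, h1, h⟩, nonempty_stab1_mulEquiv_Z4 h0 h1 h⟩
    · exact Or.inr (Or.inl ⟨⟨m, k, h0, h1, h⟩, nonempty_stab1_mulEquiv_Z2 h0 h1 h⟩)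
  · exact Or.inr (Or.inr ⟨h, card_stab1_eq_one h⟩)

theorem hasIsotropy1_Z4_iff {x : E 3} :
    HasIsotropy Gam1 (proj Gam1 x) Z4 ↔ ∃ m k : ℤ, x 0 = m ∧ x 1 = k ∧ Even (m + k) := by
  rw [hasIsotropy_proj_iff]
  constructor
  · intro h
    have h4 := card_of_mulEquiv_Z4 h
    rcases stab1_cases x with h | h | h
    · exact h.1
    · rw [card_of_mulEquiv_Z2 h.2] at h4; omega
    · rw [h.2] at h4; omega
  · rintro ⟨m, k, h0, h1, h⟩
    exact nonempty_stab1_mulEquiv_Z4 h0 h1 h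

theorem hasIsotropy1_Z2_iff {x : E 3} :
    HasIsotropy Gam1 (proj Gam1 x) Z2 ↔ ∃ m k : ℤ, x 0 = m ∧ x 1 = k ∧ Odd (m + k) := by
  rw [hasIsotropy_proj_iff]
  constructor
  · intro h
    have h2 := card_of_mulEquiv_Z2 h
    rcases stab1_cases x with h | h | h
    · rw [card_of_mulEquiv_Z4 h.2] at h2; omega
    · exact h.1
    · rw [h.2] at h2; omega
  · rintro ⟨m, k, h0, h1, h⟩
    exact nonempty_stab1_mulEquiv_Z2 h0 h1 h

theorem hasIsotropy1_of_ne_one (q : Orbifold Gam1) (hq : isotropyOrder Gam1 q ≠ 1) :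
    HasIsotropy Gam1 q Z4 ∨ HasIsotropy Gam1 q Z2 := by
  obtain ⟨x, rfl⟩ := proj_surjective _ q
  rw [hasIsotropy_proj_iff, hasIsotropy_proj_iff]
  rcases stab1_cases x with h | h | h
  exacts [Or.inl h.2, Or.inr h.2, absurd h.2 hq]

theorem isGreatest_isotropyOrder1 : IsGreatest (range (isotropyOrder Gam1)) 4 := by
  constructor
  · refine ⟨proj Gam1 0, card_of_mulEquiv_Z4 ?_⟩
    exact nonempty_stab1_mulEquiv_Z4 (m := 0) (k := 0) (by simp) (by simp) (by simp)
  · rintro _ ⟨q, rfl⟩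
    obtain ⟨x, rfl⟩ := proj_surjective _ q
    rw [isotropyOrder_proj]
    rcases stab1_cases x with h | h | h
    · exact (card_of_mulEquiv_Z4 h.2).le
    · rw [card_of_mulEquiv_Z2 h.2]; norm_num
    · rw [h.2]; norm_num

theorem mem_maxIsotropySet_iff {n : ℕ} {Γ : Subgroup (Isom n)} {N : ℕ}
    (h : IsGreatest (range (isotropyOrder Γ)) N) {q : Orbifold Γ} :
    q ∈ maxIsotropySet Γ ↔ isotropyOrder Γ q = N := by
  constructor
  · intro hq
    obtain ⟨q', hq'⟩ := h.1
    exact le_antisymm (h.2 ⟨q, rfl⟩) (hq' ▸ hq q')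
  · rintro rfl q'
    exact h.2 ⟨q', rfl⟩

theorem maxIsotropySet1_eq : maxIsotropySet Gam1 = {q | HasIsotropy Gam1 q Z4} := by
  ext q
  obtain ⟨x, rfl⟩ := proj_surjective _ q
  rw [mem_maxIsotropySet_iff isGreatest_isotropyOrder1, mem_ofPred_eq, hasIsotropy_proj_iff,
    isotropyOrder_proj]
  refine ⟨fun h4 => ?_, card_of_mulEquiv_Z4⟩
  rcases stab1_cases x with h | h | h
  · exact h.2
  · rw [card_of_mulEquiv_Z2 h.2] at h4; omega
  · rw [h.2] at h4; omega

theorem isKleinFour_of_mul_self {G : Type*} [Group G] (hc : Nat.card G = 4)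
    (h : ∀ g : G, g * g = 1) : IsKleinFour G := by
  refine ⟨hc, ?_⟩
  have h1 : Monoid.exponent G ∣ 2 :=
    Monoid.exponent_dvd_of_forall_pow_eq_one fun g => by rw [pow_two, h]
  refine ((Nat.dvd_prime Nat.prime_two).1 h1).resolve_left fun h1 => ?_
  rw [Monoid.exp_eq_one_iff] at h1
  rw [Nat.card_unique] at hc
  omega

instance : IsKleinFour (Z2 × Z2) := isKleinFour_of_mul_self (by simp) (by decide)

theorem isEmpty_Z4_mulEquiv : IsEmpty (Z4 ≃* Z2 × Z2) := by
  refine ⟨fun e => ?_⟩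
  have h : ∀ g : Z4, g * g = 1 := fun g => e.injective (by
    rw [map_mul, IsKleinFour.mul_self, map_one])
  exact absurd (h (Multiplicative.ofAdd 1)) (by decide)

theorem chi1_ne_one : chi1 ≠ 1 := fun h => by
  have := congrArg (fun γ : Isom 3 => γ (EuclideanSpace.single 1 1) 1) h
  norm_num [one_apply] at this

theorem chi2_ne_one : chi2 ≠ 1 := fun h => by
  have := congrArg (fun γ : Isom 3 => γ (EuclideanSpace.single 0 1) 0) h
  norm_num [one_apply] at this

instance : IsKleinFour pointGroup2 := by
  obtain ⟨h1, h2, h3, h4, h5, h6, h7, h8, h9⟩ := chi_mul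
  refine isKleinFour_of_mul_self ?_ ?_
  · have h12 : chi1 ≠ chi2 := fun h => chi3_ne_one (by rw [← h4, h, h2])
    have h13 : chi1 ≠ chi3 := fun h => chi2_ne_one (by rw [← h6, h, h3])
    have h23 : chi2 ≠ chi3 := fun h => chi1_ne_one (by rw [← h8, h, h3])
    change Nat.card ({1, chi1, chi2, chi3} : Set (Isom 3)) = 4
    rw [Nat.card_coe_set_eq, Set.ncard_insert_of_notMem, Set.ncard_eq_three.2
      ⟨_, _, _, h12, h13, h23, rfl⟩]
    simp [chi1_ne_one.symm, chi2_ne_one.symm, chi3_ne_one.symm]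
  · rintro ⟨ρ, hρ⟩
    refine Subtype.ext ?_
    rcases mem_pointGroup2.1 hρ with rfl | rfl | rfl | rfl
    exacts [one_mul _, h1, h2, h3]

theorem mem_range2_iff {x : E 3} {ρ : Isom 3} :
    ρ ∈ (stabLinearPart Gam2 x).range ↔ ρ = 1 ∨ ρ = chi1 ∧ IsInt (x 1) ∧ IsInt (x 2) ∨
      ρ = chi2 ∧ IsInt (x 0) ∧ IsInt (x 2) ∨ ρ = chi3 ∧ IsInt (x 0) ∧ IsInt (x 1) := by
  rw [mem_range2, mem_pointGroup2]
  constructor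
  · rintro ⟨rfl | rfl | rfl | rfl, h⟩
    · exact Or.inl rfl
    · exact Or.inr (Or.inl ⟨rfl, chi1_sub_mem.1 h⟩)
    · exact Or.inr (Or.inr (Or.inl ⟨rfl, chi2_sub_mem.1 h⟩))
    · exact Or.inr (Or.inr (Or.inr ⟨rfl, chi3_sub_mem.1 h⟩))
  · rintro (rfl | ⟨rfl, h⟩ | ⟨rfl, h⟩ | ⟨rfl, h⟩)
    · simp [one_apply]
    · exact ⟨by simp, chi1_sub_mem.2 h⟩
    · exact ⟨by simp, chi2_sub_mem.2 h⟩
    · exact ⟨by simp, chi3_sub_mem.2 h⟩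

theorem ncard_fin_three_eq_two (A : Fin 3 → Prop) :
    {i | A i}.ncard = 2 ↔
      (A 0 ∧ A 1 ∧ ¬ A 2) ∨ (A 0 ∧ ¬ A 1 ∧ A 2) ∨ (¬ A 0 ∧ A 1 ∧ A 2) := by
  classical
  rw [Set.ncard_eq_toFinset_card', Set.toFinset_ofPred, Finset.card_filter, Fin.sum_univ_three]
  split_ifs <;> simp_all

/-- The three kinds of points of `Γ₂ \ ℝ³`. -/
theorem stab2_cases (x : E 3) :
    ((∀ i, IsInt (x i)) ∧ Nonempty (stab Gam2 x ≃* Z2 × Z2)) ∨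
    ((¬ ∀ i, IsInt (x i)) ∧ {i | IsInt (x i)}.ncard = 2 ∧ Nonempty (stab Gam2 x ≃* Z2)) ∨
    ((¬ ∀ i, IsInt (x i)) ∧ {i | IsInt (x i)}.ncard ≠ 2 ∧ Nat.card (stab Gam2 x) = 1) := by
  have hall : (∀ i, IsInt (x i)) ↔ IsInt (x 0) ∧ IsInt (x 1) ∧ IsInt (x 2) := by
    rw [Fin.forall_fin_succ, Fin.forall_fin_two]; rfl
  rw [hall, Ne, ncard_fin_three_eq_two]
  obtain ⟨c1, c2, c3, -⟩ := chi_mul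
  have key : ∀ {ρ : Isom 3}, ρ * ρ = 1 → ρ ≠ 1 →
      (∀ σ, σ ∈ (stabLinearPart Gam2 x).range ↔ σ = 1 ∨ σ = ρ) →
      Nonempty (stab Gam2 x ≃* Z2) := fun {ρ} hρ hρ1 hσ =>
    nonempty_stab_mulEquiv (Subgroup.ext fun σ => by
      rw [hσ, mem_zpowers_of_mul_self hρ]) (orderOf_eq_prime (by rw [pow_two, hρ]) hρ1)
  by_cases h0 : IsInt (x 0) <;> by_cases h1 : IsInt (x 1) <;> by_cases h2 : IsInt (x 2)
  · refine Or.inl ⟨⟨h0, h1, h2⟩, ?_⟩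
    have : (stabLinearPart Gam2 x).range = pointGroup2 := by
      ext ρ; rw [mem_range2_iff]; simp [mem_pointGroup2, h0, h1, h2]
    obtain ⟨e⟩ := IsKleinFour.nonempty_mulEquiv (G₁ := pointGroup2) (G₂ := Z2 × Z2)
    exact ⟨((stabEquivRange Gam2 x).trans (MulEquiv.subgroupCongr this)).trans e⟩
  · refine Or.inr (Or.inl ⟨by simp [h2], by simp [h0, h1, h2], key c3 chi3_ne_one fun σ => ?_⟩)
    rw [mem_range2_iff]; simp [h0, h1, h2]
  · refine Or.inr (Or.inl ⟨by simp [h1], by simp [h0, h1, h2], key c2 chi2_ne_one fun σ => ?_⟩)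
    rw [mem_range2_iff]; simp [h0, h1, h2]
  · refine Or.inr (Or.inr ⟨by simp [h1], by simp [h1, h2], card_eq_one_of_range_eq_bot ?_⟩)
    ext; rw [mem_range2_iff]; simp [h1, h2]
  · refine Or.inr (Or.inl ⟨by simp [h0], by simp [h0, h1, h2], key c1 chi1_ne_one fun σ => ?_⟩)
    rw [mem_range2_iff]; simp [h0, h1, h2]
  · refine Or.inr (Or.inr ⟨by simp [h0], by simp [h0, h2], card_eq_one_of_range_eq_bot ?_⟩)
    ext; rw [mem_range2_iff]; simp [h0, h2]
  · refine Or.inr (Or.inr ⟨by simp [h0], by simp [h0, h1], card_eq_one_of_range_eq_bot ?_⟩)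
    ext; rw [mem_range2_iff]; simp [h0, h1]
  · refine Or.inr (Or.inr ⟨by simp [h0], by simp [h0, h1], card_eq_one_of_range_eq_bot ?_⟩)
    ext; rw [mem_range2_iff]; simp [h0, h1]

theorem hasIsotropy2_Z2_prod_Z2_iff (x : E 3) :
    HasIsotropy Gam2 (proj Gam2 x) (Z2 × Z2) ↔ ∀ i, ∃ m : ℤ, x i = m := by
  rw [hasIsotropy_proj_iff]
  change _ ↔ ∀ i, IsInt (x i)
  rcases stab2_cases x with h | h | h
  · exact iff_of_true h.2 h.1
  · refine iff_of_false (fun h' => ?_) h.1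
    have := card_of_mulEquiv_Z2_prod_Z2 h'
    rw [card_of_mulEquiv_Z2 h.2.2] at this; omega
  · refine iff_of_false (fun h' => ?_) h.1
    have := card_of_mulEquiv_Z2_prod_Z2 h'
    rw [h.2.2] at this; omega

theorem hasIsotropy2_Z2_iff (x : E 3) :
    HasIsotropy Gam2 (proj Gam2 x) Z2 ↔ {i | ∃ m : ℤ, x i = m}.ncard = 2 := by
  rw [hasIsotropy_proj_iff]
  change _ ↔ {i | IsInt (x i)}.ncard = 2
  rcases stab2_cases x with h | h | h
  · refine iff_of_false (fun h' => ?_) (by simp [h.1])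
    have := card_of_mulEquiv_Z2 h'
    rw [card_of_mulEquiv_Z2_prod_Z2 h.2] at this; omega
  · exact iff_of_true h.2.2 h.2.1
  · refine iff_of_false (fun h' => ?_) h.2.1
    have := card_of_mulEquiv_Z2 h'
    rw [h.2.2] at this; omega

theorem hasIsotropy2_of_ne_one (q : Orbifold Gam2) (hq : isotropyOrder Gam2 q ≠ 1) :
    HasIsotropy Gam2 q (Z2 × Z2) ∨ HasIsotropy Gam2 q Z2 := by
  obtain ⟨x, rfl⟩ := proj_surjective _ q
  rw [hasIsotropy_proj_iff, hasIsotropy_proj_iff]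
  rcases stab2_cases x with h | h | h
  exacts [Or.inl h.2, Or.inr h.2.2, absurd h.2.2 hq]

theorem isGreatest_isotropyOrder2 : IsGreatest (range (isotropyOrder Gam2)) 4 := by
  constructor
  · refine ⟨proj Gam2 0, card_of_mulEquiv_Z2_prod_Z2 (hasIsotropy_proj_iff.1 ?_)⟩
    exact (hasIsotropy2_Z2_prod_Z2_iff 0).2 fun i => ⟨0, by simp⟩
  · rintro _ ⟨q, rfl⟩
    obtain ⟨x, rfl⟩ := proj_surjective _ q
    rw [isotropyOrder_proj]
    rcases stab2_cases x with h | h | h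
    · exact (card_of_mulEquiv_Z2_prod_Z2 h.2).le
    · rw [card_of_mulEquiv_Z2 h.2.2]; norm_num
    · rw [h.2.2]; norm_num

theorem maxIsotropySet2_eq : maxIsotropySet Gam2 = {q | HasIsotropy Gam2 q (Z2 × Z2)} := by
  ext q
  obtain ⟨x, rfl⟩ := proj_surjective _ q
  rw [mem_maxIsotropySet_iff isGreatest_isotropyOrder2, mem_ofPred_eq, hasIsotropy_proj_iff,
    isotropyOrder_proj]
  refine ⟨fun h4 => ?_, card_of_mulEquiv_Z2_prod_Z2⟩
  rcases stab2_cases x with h | h | h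
  · exact h.2
  · rw [card_of_mulEquiv_Z2 h.2.2] at h4; omega
  · rw [h.2.2] at h4; omega

/-! ### The singular sets -/

theorem eq_of_isEvenInt_sub {r s : ℝ} (hr : r ∈ Ico (0 : ℝ) 2) (hs : s ∈ Ico (0 : ℝ) 2)
    (h : IsEvenInt (s - r)) : r = s := by
  obtain ⟨m, hm⟩ := h
  have h1 : (-1 : ℝ) < m := by linarith [hr.2, hs.1]
  have h2 : (m : ℝ) < 1 := by linarith [hr.1, hs.2]
  have h1' : -1 < m := by exact_mod_cast h1
  have h2' : m < 1 := by exact_mod_cast h2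
  obtain rfl : m = 0 := by omega
  simp at hm
  linarith

theorem exists_isEvenInt_sub (t : ℝ) : ∃ r ∈ Ico (0 : ℝ) 2, IsEvenInt (t - r) := by
  have h1 := Int.floor_le (t / 2)
  have h2 := Int.lt_floor_add_one (t / 2)
  exact ⟨t - 2 * ⌊t / 2⌋, ⟨by linarith, by linarith⟩, ⌊t / 2⌋, by ring⟩

theorem bit_mem_Ico (b : Fin 2) : ((b : ℕ) : ℝ) ∈ Ico (0 : ℝ) 2 :=
  ⟨by positivity, by exact_mod_cast b.2⟩

theorem isInt_bit (b : Fin 2) : IsInt ((b : ℕ) : ℝ) := ⟨b, by simp⟩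

theorem isEvenInt_add_iff_sub {s t : ℝ} (ht : IsInt t) : IsEvenInt (s + t) ↔ IsEvenInt (s - t) := by
  obtain ⟨k, rfl⟩ := ht
  constructor <;> rintro ⟨m, hm⟩
  · exact ⟨m - k, by push_cast; linarith⟩
  · exact ⟨m + k, by push_cast; linarith⟩

theorem bit_injective {b c : Fin 2} (h : ((b : ℕ) : ℝ) = (c : ℕ)) : b = c :=
  Fin.ext (by exact_mod_cast h)

theorem exists_bit {t : ℝ} (h : IsInt t) : ∃ b : Fin 2, IsEvenInt (t - (b : ℕ)) := by
  obtain ⟨m, rfl⟩ := h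
  rcases Int.even_or_odd' m with ⟨k, rfl | rfl⟩
  · exact ⟨0, k, by simp⟩
  · exact ⟨1, k, by simp⟩

theorem line_apply {a b r : ℝ} :
    (!₂[a, b, 0] + r • EuclideanSpace.single 2 1 : E 3) = !₂[a, b, r] := by
  refine fin3_ext ?_ ?_ ?_ <;> simp

theorem isEvenInt_two_third {x y : E 3} (h : proj Gam1 x = proj Gam1 y) :
    IsEvenInt (y 2 - x 2) := by
  obtain ⟨ρ, hρ, h⟩ := proj1_eq_iff.1 h
  have := (mem_lattice'.1 h).2.2
  rcases mem_pointGroup1'.1 hρ with rfl | rfl | rfl | rfl <;>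
  simpa [mul_apply, one_apply] using this

/-- On the third coordinate axis and the parallel line through `(1, 1, 0)`, equivalence under `Γ₁`
is nothing but translation by `2ℤ` along the lines. -/
theorem proj1_diag_injective {k l : Fin 2} {r s : ℝ} (hr : r ∈ Ico (0 : ℝ) 2)
    (hs : s ∈ Ico (0 : ℝ) 2)
    (h : proj Gam1 !₂[((k : ℕ) : ℝ), (k : ℕ), r] = proj Gam1 !₂[((l : ℕ) : ℝ), (l : ℕ), s]) :
    k = l ∧ r = s := by
  refine ⟨?_, eq_of_isEvenInt_sub hr hs (by simpa using isEvenInt_two_third h)⟩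
  obtain ⟨ρ, hρ, h⟩ := proj1_eq_iff.1 h
  have h0 := (mem_lattice'.1 h).1
  refine bit_injective (eq_of_isEvenInt_sub (bit_mem_Ico k) (bit_mem_Ico l) ?_)
  rcases mem_pointGroup1'.1 hρ with rfl | rfl | rfl | rfl <;>
  simpa [mul_apply, one_apply, isEvenInt_add_iff_sub (isInt_bit k)] using h0

theorem exists_proj1_eq_diag {x : E 3} {m k : ℤ} (h0 : x 0 = m) (h1 : x 1 = k)
    (h : Even (m + k)) : ∃ b : Fin 2, ∃ r ∈ Ico (0 : ℝ) 2,
      proj Gam1 !₂[((b : ℕ) : ℝ), (b : ℕ), r] = proj Gam1 x := by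
  obtain ⟨b, hb⟩ := exists_bit ⟨m, h0⟩
  obtain ⟨r, hr, hr'⟩ := exists_isEvenInt_sub (x 2)
  refine ⟨b, r, hr, proj1_eq_iff.2 ⟨1, Subgroup.one_mem _, mem_lattice'.2 ⟨hb, ?_, hr'⟩⟩⟩
  obtain ⟨a, ha⟩ := hb
  obtain ⟨c, hc⟩ := h
  have hc' : (m + k : ℝ) = c + c := by exact_mod_cast hc
  refine ⟨c - m + a, ?_⟩
  simp only [one_apply, PiLp.sub_apply, Matrix.cons_val_one, Matrix.cons_val_zero]
  rw [h0] at ha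
  rw [h1]
  push_cast
  linarith

theorem hasIsotropy1_diag (b : Fin 2) (r : ℝ) :
    HasIsotropy Gam1 (proj Gam1 !₂[((b : ℕ) : ℝ), (b : ℕ), r]) Z4 :=
  hasIsotropy1_Z4_iff.2 ⟨b, b, by simp, by simp, ⟨b, rfl⟩⟩

theorem isUnionOfCircles_Z4 : IsUnionOfCircles Gam1 {q | HasIsotropy Gam1 q Z4} 2 2 := by
  refine ⟨fun k => !₂[((k : ℕ) : ℝ), (k : ℕ), 0], fun _ => EuclideanSpace.single 2 1,
    fun _ => by simp, fun k r => ?_, ?_, ?_⟩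
  · simp only [line_apply]
    exact proj1_eq_iff.2 ⟨1, Subgroup.one_mem _, mem_lattice'.2
      ⟨by simp [one_apply], by simp [one_apply], ⟨-1, by simp [one_apply]⟩⟩⟩
  · rintro ⟨k, r⟩ ⟨-, hr⟩ ⟨l, s⟩ ⟨-, hs⟩ h
    simp only [line_apply] at h
    obtain ⟨rfl, rfl⟩ := proj1_diag_injective hr hs h
    rfl
  · ext q
    simp only [line_apply]
    constructor
    · rintro ⟨⟨k, r⟩, -, rfl⟩
      exact hasIsotropy1_diag k r
    · intro hq
      obtain ⟨x, rfl⟩ := proj_surjective _ q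
      obtain ⟨m, k, h0, h1, h⟩ := hasIsotropy1_Z4_iff.1 hq
      obtain ⟨b, r, hr, e⟩ := exists_proj1_eq_diag h0 h1 h
      exact ⟨(b, r), ⟨mem_univ _, hr⟩, e⟩

theorem isUnionOfCircles_Z2 : IsUnionOfCircles Gam1 {q | HasIsotropy Gam1 q Z2} 1 2 := by
  refine ⟨fun _ => !₂[1, 0, 0], fun _ => EuclideanSpace.single 2 1,
    fun _ => by simp, fun k r => ?_, ?_, ?_⟩
  · simp only [line_apply]
    exact proj1_eq_iff.2 ⟨1, Subgroup.one_mem _, mem_lattice'.2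
      ⟨by simp [one_apply], by simp [one_apply], ⟨-1, by simp [one_apply]⟩⟩⟩
  · rintro ⟨k, r⟩ ⟨-, hr⟩ ⟨l, s⟩ ⟨-, hs⟩ h
    simp only [line_apply] at h
    obtain rfl : r = s := eq_of_isEvenInt_sub hr hs (by simpa using isEvenInt_two_third h)
    rw [Subsingleton.elim k l]
  · ext q
    simp only [line_apply]
    constructor
    · rintro ⟨⟨k, r⟩, -, rfl⟩
      exact hasIsotropy1_Z2_iff.2 ⟨1, 0, by simp, by simp, by simp⟩
    · intro hq
      obtain ⟨x, rfl⟩ := proj_surjective _ q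
      obtain ⟨m, k, h0, h1, h⟩ := hasIsotropy1_Z2_iff.1 hq
      obtain ⟨r, hr, hr'⟩ := exists_isEvenInt_sub (x 2)
      refine ⟨(0, r), ⟨mem_univ _, hr⟩, proj1_eq_iff.2 ?_⟩
      rcases Int.even_or_odd m with hm | hm
      · -- `τ` exchanges the two lines of opposite parities
        refine ⟨tau, Subgroup.mem_zpowers _, mem_lattice'.2 ⟨?_, ?_, by simpa using hr'⟩⟩
        · simpa [h0] using isEvenInt_intCast.2 hm
        · have : Even (k - 1) := by
            rw [Int.even_sub]; simpa using Int.not_even_iff_odd.2 ((Int.odd_add'.1 h).2 hm)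
          simpa [h1] using isEvenInt_intCast.2 this
      · refine ⟨1, Subgroup.one_mem _, mem_lattice'.2 ⟨?_, ?_, by simpa [one_apply] using hr'⟩⟩
        · have : Even (m - 1) := by
            rw [Int.even_sub]; simpa using Int.not_even_iff_odd.2 hm
          simpa [h0, one_apply] using isEvenInt_intCast.2 this
        · simpa [h1, one_apply] using isEvenInt_intCast.2 ((Int.odd_add.1 h).1 hm)

theorem pointGroup2_apply {ρ : Isom 3} (hρ : ρ ∈ pointGroup2) (x : E 3) (j : Fin 3) :
    ρ x j = x j ∨ ρ x j = -x j := by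
  rcases mem_pointGroup2.1 hρ with rfl | rfl | rfl | rfl <;> fin_cases j <;> simp [one_apply]

/-- Every coordinate is reflected by some element of the point group of `Γ₂`. -/
theorem exists_pointGroup2_neg (i : Fin 3) : ∃ ρ ∈ pointGroup2, ∀ x, ρ x i = -x i := by
  fin_cases i
  · exact ⟨chi2, mem_pointGroup2.2 (by simp), by simp⟩
  · exact ⟨chi1, mem_pointGroup2.2 (by simp), by simp⟩
  · exact ⟨chi1, mem_pointGroup2.2 (by simp), by simp⟩

theorem isEvenInt_of_proj2_eq {x y : E 3} (h : proj Gam2 x = proj Gam2 y) (j : Fin 3) :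
    IsEvenInt (y j - x j) ∨ IsEvenInt (y j + x j) := by
  obtain ⟨ρ, hρ, h⟩ := proj2_eq_iff.1 h
  have : IsEvenInt (y j - ρ x j) := mem_lattice.1 h j
  rcases pointGroup2_apply hρ x j with e | e
  · left; simpa [e] using this
  · right; simpa [e] using this

theorem eq_of_proj2_eq {x y : E 3} (h : proj Gam2 x = proj Gam2 y) {j : Fin 3}
    (hx : x j ∈ Icc (0 : ℝ) 1) (hy : y j ∈ Icc (0 : ℝ) 1) : x j = y j := by
  rcases isEvenInt_of_proj2_eq h j with h | ⟨m, hm⟩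
  · exact eq_of_isEvenInt_sub ⟨hx.1, by linarith [hx.2]⟩ ⟨hy.1, by linarith [hy.2]⟩ h
  · -- the sum of two numbers of `[0, 1]` is `0` or `2` only if both are `0` or both are `1`
    have h1 : (-1 : ℝ) < m := by linarith [hx.1, hy.1]
    have h2 : (m : ℝ) < 2 := by linarith [hx.2, hy.2]
    have h1' : -1 < m := by exact_mod_cast h1
    have h2' : m < 2 := by exact_mod_cast h2
    obtain rfl | rfl : m = 0 ∨ m = 1 := by omega
    · simp at hm; linarith [hx.1, hy.1]
    · simp at hm; linarith [hx.2, hy.2]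

theorem bit_mem_Icc (b : Fin 2) : ((b : ℕ) : ℝ) ∈ Icc (0 : ℝ) 1 :=
  ⟨by positivity, by exact_mod_cast Nat.lt_succ_iff.1 b.2⟩

/-- Modulo `2`, integers do not notice a change of sign. So if all coordinates but the `i`-th are
integers, any element of the point group that reflects the `i`-th coordinate reflects, modulo `Λ`,
that coordinate alone. -/
theorem proj2_eq_of_sub {x y : E 3} (i : Fin 3)
    (h : ∀ j, j ≠ i → IsInt (x j) ∧ IsEvenInt (y j - x j))
    (hi : IsEvenInt (y i - x i) ∨ IsEvenInt (y i + x i)) : proj Gam2 x = proj Gam2 y := by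
  rw [proj2_eq_iff]
  rcases hi with hi | hi
  · refine ⟨1, Subgroup.one_mem _, fun j => ?_⟩
    by_cases hj : j = i
    · subst hj; exact hi
    · exact (h j hj).2
  · obtain ⟨ρ, hρ, hneg⟩ := exists_pointGroup2_neg i
    refine ⟨ρ, hρ, fun j => ?_⟩
    change IsEvenInt (y j - ρ x j)
    by_cases hj : j = i
    · subst hj; rw [hneg, sub_neg_eq_add]; exact hi
    · rcases pointGroup2_apply hρ x j with e | e
      · rw [e]; exact (h j hj).2
      · rw [e, sub_neg_eq_add, isEvenInt_add_iff_sub (h j hj).1]; exact (h j hj).2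

theorem ncard_hasIsotropy2_Z2_prod_Z2 : {q | HasIsotropy Gam2 q (Z2 × Z2)}.ncard = 8 := by
  set f : (Fin 3 → Fin 2) → Orbifold Gam2 := fun c =>
    proj Gam2 (WithLp.toLp 2 fun i => ((c i : ℕ) : ℝ)) with hf
  have hinj : Function.Injective f := fun c d h => by
    funext i
    exact bit_injective (eq_of_proj2_eq h (bit_mem_Icc (c i)) (bit_mem_Icc (d i)))
  have : {q | HasIsotropy Gam2 q (Z2 × Z2)} = f '' univ := by
    ext q
    rw [image_univ]
    constructor
    · intro hq
      obtain ⟨x, rfl⟩ := proj_surjective _ q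
      have hx := (hasIsotropy2_Z2_prod_Z2_iff x).1 hq
      choose b hb using fun i => exists_bit (hx i)
      exact ⟨b, proj2_eq_of_sub 0 (fun j _ => ⟨isInt_bit _, hb j⟩) (Or.inl (hb 0))⟩
    · rintro ⟨c, rfl⟩
      exact (hasIsotropy2_Z2_prod_Z2_iff _).2 fun i => isInt_bit (c i)
  rw [this, ncard_image_of_injective _ hinj, ncard_univ]
  simp

/-- The point of the unit cube on the edge in direction `i` whose two integral coordinates are given
by the function `c` on the set of the other two indices. -/
def edgePoint (i : Fin 3) (c : {j // j ≠ i} → Fin 2) (r : ℝ) : E 3 :=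
  WithLp.toLp 2 fun j => if h : j = i then r else ((c ⟨j, h⟩ : ℕ) : ℝ)

theorem edgePoint_self (i : Fin 3) (c : {j // j ≠ i} → Fin 2) (r : ℝ) :
    edgePoint i c r i = r := by simp [edgePoint]

theorem edgePoint_of_ne {i : Fin 3} (c : {j // j ≠ i} → Fin 2) (r : ℝ) {j : Fin 3} (h : j ≠ i) :
    edgePoint i c r j = ((c ⟨j, h⟩ : ℕ) : ℝ) := by simp [edgePoint, h]

theorem edgePoint_eq (i : Fin 3) (c : {j // j ≠ i} → Fin 2) (r : ℝ) :
    edgePoint i c 0 + r • EuclideanSpace.single i 1 = edgePoint i c r := by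
  ext j
  by_cases h : j = i
  · subst h; simp [edgePoint]
  · simp [edgePoint, h]

theorem not_isInt_of_mem_Ioo {r : ℝ} (hr : r ∈ Ioo (0 : ℝ) 1) : ¬ IsInt r := by
  rintro ⟨m, rfl⟩
  have h1 : 0 < m := by exact_mod_cast hr.1
  have h2 : m < 1 := by exact_mod_cast hr.2
  omega

theorem edgePoint_mem_Icc (i : Fin 3) (c : {j // j ≠ i} → Fin 2) {r : ℝ}
    (hr : r ∈ Ioo (0 : ℝ) 1) (j : Fin 3) : edgePoint i c r j ∈ Icc (0 : ℝ) 1 := by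
  by_cases h : j = i
  · subst h; rw [edgePoint_self]; exact ⟨hr.1.le, hr.2.le⟩
  · rw [edgePoint_of_ne c r h]; exact bit_mem_Icc _

theorem ncard_fin_three_eq_two' (A : Fin 3 → Prop) :
    {i | A i}.ncard = 2 ↔ ∃ i, ¬ A i ∧ ∀ j, j ≠ i → A j := by
  rw [ncard_fin_three_eq_two]
  simp only [Fin.exists_fin_succ, Fin.forall_fin_succ]
  simp
  tauto

theorem isUnionOfOpenSegments_Z2 :
    IsUnionOfOpenSegments Gam2 {q | HasIsotropy Gam2 q Z2} 12 1 := by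
  -- three directions, and for each of them four choices of the other two coordinates
  have e : Fin 12 ≃ Σ i : Fin 3, ({j // j ≠ i} → Fin 2) := by
    refine (Fintype.equivFinOfCardEq ?_).symm
    decide
  refine ⟨fun k => edgePoint (e k).1 (e k).2 0, fun k => EuclideanSpace.single (e k).1 1,
    fun _ => by simp, ?_, ?_⟩
  · simp only [edgePoint_eq]
    rintro ⟨k, r⟩ ⟨-, hr⟩ ⟨l, s⟩ ⟨-, hs⟩ h
    have hr : r ∈ Ioo (0 : ℝ) 1 := hr
    have hs : s ∈ Ioo (0 : ℝ) 1 := hs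
    dsimp only at h
    obtain ⟨⟨i, c⟩, rfl⟩ := e.symm.surjective k
    obtain ⟨⟨i', c'⟩, rfl⟩ := e.symm.surjective l
    rw [Equiv.apply_symm_apply, Equiv.apply_symm_apply] at h
    have hj := fun j => eq_of_proj2_eq h (edgePoint_mem_Icc i c hr j) (edgePoint_mem_Icc i' c' hs j)
    obtain rfl : i = i' := by
      by_contra hne
      have := hj i
      rw [edgePoint_self, edgePoint_of_ne _ _ hne] at this
      exact not_isInt_of_mem_Ioo hr (this ▸ isInt_bit _)
    have hrs : r = s := by simpa [edgePoint_self] using hj i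
    have hc : c = c' := by
      funext ⟨j, hji⟩
      have := hj j
      rw [edgePoint_of_ne _ _ hji, edgePoint_of_ne _ _ hji] at this
      exact bit_injective this
    rw [hrs, hc]
  · simp only [edgePoint_eq]
    ext q
    constructor
    · rintro ⟨⟨k, r⟩, ⟨-, hr⟩, rfl⟩
      refine (hasIsotropy2_Z2_iff _).2 ((ncard_fin_three_eq_two' _).2 ⟨(e k).1, ?_, fun j hj => ?_⟩)
      · rw [edgePoint_self]; exact not_isInt_of_mem_Ioo hr
      · rw [edgePoint_of_ne _ _ hj]; exact isInt_bit _
    · intro hq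
      obtain ⟨x, rfl⟩ := proj_surjective _ q
      obtain ⟨i, hi, hj⟩ := (ncard_fin_three_eq_two' _).1 ((hasIsotropy2_Z2_iff x).1 hq)
      choose c hc using fun j : {j // j ≠ i} => exists_bit (hj j.1 j.2)
      have hr : ∃ r ∈ Ioo (0 : ℝ) 1, IsEvenInt (x i - r) ∨ IsEvenInt (x i + r) := by
        obtain ⟨r, hr, m, hm⟩ := exists_isEvenInt_sub (x i)
        -- a representative in `(1, 2)` is reflected to one in `(0, 1)`
        have h0 : r ≠ 0 := fun h => hi ⟨2 * m, by push_cast; linarith⟩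
        have h1 : r ≠ 1 := fun h => hi ⟨2 * m + 1, by push_cast; linarith⟩
        rcases lt_or_gt_of_ne h1 with h | h
        · exact ⟨r, ⟨lt_of_le_of_ne hr.1 h0.symm, h⟩, Or.inl ⟨m, hm⟩⟩
        · exact ⟨2 - r, ⟨by linarith [hr.2], by linarith⟩, Or.inr ⟨m + 1, by push_cast; linarith⟩⟩
      obtain ⟨r, hr, h⟩ := hr
      refine ⟨(e.symm ⟨i, c⟩, r), ⟨mem_univ _, hr⟩, ?_⟩
      dsimp only
      rw [Equiv.apply_symm_apply]
      refine proj2_eq_of_sub i (fun j hji => ?_) (by rwa [edgePoint_self])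
      rw [edgePoint_of_ne _ _ hji]
      exact ⟨isInt_bit _, hc ⟨j, hji⟩⟩

/-! ### Dimensions of the sets of points of maximal isotropy -/

theorem hasSmallInductiveDimensionLT_one_of_finite (X : Type*) [TopologicalSpace X] [T1Space X]
    [Finite X] : HasSmallInductiveDimensionLT X 1 := by
  rw [hasSmallInductiveDimensionLT_one_iff]
  exact TopologicalSpace.isTopologicalBasis_of_isOpen_of_nhds (fun _ h => h.isOpen)
    fun a u ha hu => ⟨{a}, isClopen_discrete _, rfl, singleton_subset_iff.2 ha⟩

/-- A space which embeds in a metric space so that all spheres about its points meet it in finite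
sets is at most one-dimensional. -/
theorem hasSmallInductiveDimensionLE_one {X Y : Type*} [TopologicalSpace X] [MetricSpace Y]
    {f : X → Y} (hf : Topology.IsEmbedding f)
    (h : ∀ (q : X) (t : ℝ), 0 < t → {x | dist (f x) (f q) = t}.Finite) :
    HasSmallInductiveDimensionLE X 1 := by
  have : T2Space X := hf.t2Space
  refine .succ 1 {U | IsOpen U ∧ (frontier U).Finite} ?_ ?_
  · refine TopologicalSpace.isTopologicalBasis_of_isOpen_of_nhds (fun _ h => h.1)
      fun q u hq hu => ?_
    have hu' : u ∈ nhds q := hu.mem_nhds hq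
    rw [hf.nhds_eq_comap, (Metric.nhds_basis_ball.comap f).mem_iff] at hu'
    obtain ⟨t, ht, htu⟩ := hu'
    have hc : Continuous fun x => dist (f x) (f q) := hf.continuous.dist continuous_const
    refine ⟨_, ⟨isOpen_lt hc continuous_const, (h q t ht).subset ?_⟩, ?_, htu⟩
    · exact frontier_lt_subset_eq hc continuous_const
    · simpa using ht
  · rintro U ⟨-, hU⟩
    have := hU.to_subtype
    exact hasSmallInductiveDimensionLT_one_of_finite _

/-- A `T1` space containing a nonconstant path is not zero-dimensional: a clopen set containing one
point of the path contains the whole path. -/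
theorem not_hasSmallInductiveDimensionLT_one {X : Type*} [TopologicalSpace X] [T1Space X]
    {f : ℝ → X} (hf : Continuous f) {a b : ℝ} (hab : f a ≠ f b) :
    ¬ HasSmallInductiveDimensionLT X 1 := by
  rw [hasSmallInductiveDimensionLT_one_iff]
  intro h
  obtain ⟨C, hC, haC, hCb⟩ := h.exists_subset_of_mem_open
    (show f a ∈ ({f b}ᶜ : Set X) from hab) isOpen_compl_singleton
  have h1 : f ⁻¹' C = univ := (isClopen_iff.1 (hC.preimage hf)).resolve_left
    (Nonempty.ne_empty ⟨a, haC⟩)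
  exact hCb (show b ∈ f ⁻¹' C from h1 ▸ mem_univ b) rfl

/-- Two circles in the plane with distinct centers meet in a finite set. -/
theorem finite_norm_eq_dist_eq {w : ℂ} (hw : w ≠ 0) (a t : ℝ) :
    {z : ℂ | ‖z‖ = a ∧ dist z w = t}.Finite := by
  set b := (a ^ 2 + ‖w‖ ^ 2 - t ^ 2) / 2 with hb
  set c := Real.sqrt (a ^ 2 * ‖w‖ ^ 2 - b ^ 2)
  have hw' : starRingEnd ℂ w ≠ 0 := by simpa using hw
  refine Set.Finite.of_finite_image (f := fun z => z * starRingEnd ℂ w)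
    ((Set.toFinite {(⟨b, c⟩ : ℂ), ⟨b, -c⟩}).subset ?_) (mul_left_injective₀ hw').injOn
  rintro _ ⟨z, ⟨rfl, rfl⟩, rfl⟩
  have h1 : (z * starRingEnd ℂ w).re = b := by
    rw [hb, dist_eq_norm, ← Complex.normSq_eq_norm_sq, ← Complex.normSq_eq_norm_sq,
      ← Complex.normSq_eq_norm_sq, Complex.normSq_sub]
    ring
  have h2 : (z * starRingEnd ℂ w).im ^ 2 = ‖z‖ ^ 2 * ‖w‖ ^ 2 - b ^ 2 := by
    have : Complex.normSq (z * starRingEnd ℂ w) = ‖z‖ ^ 2 * ‖w‖ ^ 2 := by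
      rw [Complex.normSq_mul, Complex.normSq_conj, Complex.normSq_eq_norm_sq,
        Complex.normSq_eq_norm_sq]
    rw [← this, Complex.normSq_apply, ← h1]
    ring
  have h3 : (z * starRingEnd ℂ w).im ^ 2 = c ^ 2 := by
    rw [Real.sq_sqrt (h2 ▸ sq_nonneg _), h2]
  rcases sq_eq_sq_iff_eq_or_eq_neg.1 h3 with h | h
  · left; exact Complex.ext h1 h
  · right; exact Complex.ext h1 h

theorem cos_pi_eq_of_isEvenInt {s t : ℝ} (h : IsEvenInt (s - t)) :
    Real.cos (Real.pi * s) = Real.cos (Real.pi * t) := by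
  obtain ⟨m, hm⟩ := h
  rw [show Real.pi * s = Real.pi * t + m * (2 * Real.pi) by linear_combination Real.pi * hm,
    Real.cos_add_int_mul_two_pi]

theorem exp_pi_eq_iff_isEvenInt {s t : ℝ} :
    Complex.exp ((Real.pi * s : ℝ) * Complex.I) = Complex.exp ((Real.pi * t : ℝ) * Complex.I) ↔
      IsEvenInt (s - t) := by
  rw [Complex.exp_eq_exp_iff_exists_int]
  refine exists_congr fun m => ?_
  have hpi := Real.pi_pos.ne'
  rw [show ((Real.pi * t : ℝ) * Complex.I + m * (2 * Real.pi * Complex.I) : ℂ) =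
    ((Real.pi * t + m * (2 * Real.pi) : ℝ) : ℂ) * Complex.I by push_cast; ring,
    mul_left_inj' Complex.I_ne_zero, Complex.ofReal_inj]
  constructor
  · intro h; apply mul_left_cancel₀ hpi; linarith
  · intro h; linear_combination Real.pi * h

/-- A function on `ℝ³` whose restriction to the axes of the quarter turns in `Γ₁` wraps them onto
two concentric circles, of radius `3` over the third coordinate axis and of radius `1` over the
parallel axis through `(1, 1, 0)`. -/
def wrap (x : E 3) : ℂ :=
  ((2 + (Real.cos (Real.pi * x 0) + Real.cos (Real.pi * x 1)) / 2 : ℝ) : ℂ) *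
    Complex.exp ((Real.pi * x 2 : ℝ) * Complex.I)

theorem continuous_wrap : Continuous wrap := by
  unfold wrap
  fun_prop

theorem wrap_eq_of_proj_eq {x y : E 3} (h : proj Gam1 x = proj Gam1 y) : wrap x = wrap y := by
  have h2 := exp_pi_eq_iff_isEvenInt.2 (isEvenInt_two_third h)
  obtain ⟨ρ, hρ, h⟩ := proj1_eq_iff.1 h
  obtain ⟨h0, h1, -⟩ := mem_lattice'.1 h
  have h0 := cos_pi_eq_of_isEvenInt (s := y 0) (t := ρ x 0) h0
  have h1 := cos_pi_eq_of_isEvenInt (s := y 1) (t := ρ x 1) h1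
  rw [wrap, wrap, h2, h0, h1]
  rcases mem_pointGroup1'.1 hρ with rfl | rfl | rfl | rfl <;>
  simp [mul_apply, one_apply, add_comm]

theorem wrap_diag (b : Fin 2) (r : ℝ) : wrap !₂[((b : ℕ) : ℝ), (b : ℕ), r] =
    ((3 - 2 * (b : ℕ) : ℝ) : ℂ) * Complex.exp ((Real.pi * r : ℝ) * Complex.I) := by
  fin_cases b
  · simp [wrap]; norm_num
  · simp [wrap]; norm_num

theorem norm_wrap_diag (b : Fin 2) (r : ℝ) :
    ‖wrap !₂[((b : ℕ) : ℝ), (b : ℕ), r]‖ = 3 - 2 * (b : ℕ) := by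
  rw [wrap_diag, norm_mul, Complex.norm_exp_ofReal_mul_I, Complex.norm_real, mul_one]
  fin_cases b <;> norm_num

/-- The map induced by `wrap` on `Γ₁ \ ℝ³`. -/
def wrapQuot : Orbifold Gam1 → ℂ := Quotient.lift wrap fun _ _ h =>
  wrap_eq_of_proj_eq (Quotient.sound h)

theorem exists_eq_diag (q : maxIsotropySet Gam1) : ∃ b : Fin 2, ∃ r ∈ Ico (0 : ℝ) 2,
    q.1 = proj Gam1 !₂[((b : ℕ) : ℝ), (b : ℕ), r] := by
  obtain ⟨q, hq⟩ := q
  rw [maxIsotropySet1_eq] at hq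
  obtain ⟨x, rfl⟩ := proj_surjective _ q
  obtain ⟨m, k, h0, h1, h⟩ := hasIsotropy1_Z4_iff.1 hq
  obtain ⟨b, r, hr, e⟩ := exists_proj1_eq_diag h0 h1 h
  exact ⟨b, r, hr, e.symm⟩

/-- The image of the line of all `(b, b, r)`, `r ∈ ℝ`, in the set of points of maximal isotropy of
`Γ₁ \ ℝ³`. -/
def diagLine (b : Fin 2) (r : ℝ) : maxIsotropySet Gam1 :=
  ⟨proj Gam1 !₂[((b : ℕ) : ℝ), (b : ℕ), r], by
    rw [maxIsotropySet1_eq]; exact hasIsotropy1_diag b r⟩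

theorem continuous_diagLine (b : Fin 2) : Continuous (diagLine b) := by
  refine Continuous.subtype_mk ((continuous_proj _).comp ?_) _
  refine (PiLp.continuous_toLp 2 _).comp (continuous_pi fun i => ?_)
  fin_cases i
  exacts [continuous_const, continuous_const, continuous_id]

theorem compactSpace_maxIsotropySet1 : CompactSpace (maxIsotropySet Gam1) := by
  refine ⟨?_⟩
  have := isCompact_iUnion fun b : Fin 2 => isCompact_Icc.image (continuous_diagLine b)
    (s := Icc (0 : ℝ) 2)
  convert this
  refine (eq_univ_of_forall fun q => ?_).symm
  obtain ⟨b, r, hr, e⟩ := exists_eq_diag q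
  exact mem_iUnion.2 ⟨b, r, Ico_subset_Icc_self hr, Subtype.ext e.symm⟩

theorem isEmbedding_wrapQuot :
    Topology.IsEmbedding fun q : maxIsotropySet Gam1 => wrapQuot q.1 := by
  have := compactSpace_maxIsotropySet1
  have hc : Continuous fun q : maxIsotropySet Gam1 => wrapQuot q.1 :=
    (continuous_wrap.quotient_lift _).comp continuous_subtype_val
  refine (hc.isClosedEmbedding fun q q' h => ?_).isEmbedding
  obtain ⟨b, r, hr, e⟩ := exists_eq_diag q
  obtain ⟨c, s, hs, e'⟩ := exists_eq_diag q'
  have h : wrap !₂[((b : ℕ) : ℝ), (b : ℕ), r] = wrap !₂[((c : ℕ) : ℝ), (c : ℕ), s] := by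
    rw [e, e'] at h
    exact h
  have hbc : b = c := by
    have := congrArg norm h
    rw [norm_wrap_diag, norm_wrap_diag] at this
    exact bit_injective (by linarith)
  subst hbc
  refine Subtype.ext ?_
  rw [e, e']
  have hb : ((3 - 2 * (b : ℕ) : ℝ) : ℂ) ≠ 0 := by
    rw [Complex.ofReal_ne_zero]; fin_cases b <;> norm_num
  rw [wrap_diag, wrap_diag, mul_right_inj' hb, exp_pi_eq_iff_isEvenInt] at h
  rw [eq_of_isEvenInt_sub hs hr h]

theorem norm_wrapQuot (q : maxIsotropySet Gam1) : ‖wrapQuot q.1‖ = 3 ∨ ‖wrapQuot q.1‖ = 1 := by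
  obtain ⟨b, r, -, e⟩ := exists_eq_diag q
  rw [e]
  change ‖wrap _‖ = 3 ∨ ‖wrap _‖ = 1
  rw [norm_wrap_diag]
  fin_cases b <;> norm_num

theorem smallInductiveDimension_maxIsotropySet1 :
    smallInductiveDimension (maxIsotropySet Gam1) = 1 := by
  refine smallInductiveDimension_eq 1 ?_ ?_
  · refine hasSmallInductiveDimensionLE_one isEmbedding_wrapQuot fun q t _ => ?_
    have hq : wrapQuot q.1 ≠ 0 := by
      rw [← norm_ne_zero_iff]; rcases norm_wrapQuot q with h | h <;> rw [h] <;> norm_num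
    refine Set.Finite.of_finite_image (((finite_norm_eq_dist_eq hq 3 t).union
      (finite_norm_eq_dist_eq hq 1 t)).subset ?_) isEmbedding_wrapQuot.injective.injOn
    rintro _ ⟨x, hx, rfl⟩
    rcases norm_wrapQuot x with h | h
    exacts [Or.inl ⟨h, hx⟩, Or.inr ⟨h, hx⟩]
  · refine not_hasSmallInductiveDimensionLT_one (continuous_diagLine 0) (a := 0) (b := 1) ?_
    intro h
    have := (proj1_diag_injective (by simp) (by simp) (congrArg Subtype.val h)).2
    norm_num at this

theorem smallInductiveDimension_maxIsotropySet2 :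
    smallInductiveDimension (maxIsotropySet Gam2) = 0 := by
  have hcard : (maxIsotropySet Gam2).ncard = 8 := by
    rw [maxIsotropySet2_eq, ncard_hasIsotropy2_Z2_prod_Z2]
  have hne : (maxIsotropySet Gam2).Nonempty := nonempty_of_ncard_ne_zero (by omega)
  have := (finite_of_ncard_ne_zero (by omega : (maxIsotropySet Gam2).ncard ≠ 0)).to_subtype
  refine smallInductiveDimension_eq 0 (hasSmallInductiveDimensionLT_one_of_finite _) ?_
  rw [hasSmallInductiveDimensionLT_zero_iff, not_isEmpty_iff]
  exact hne.to_subtype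

/-! ### Fourier series of eigenfunctions on the torus `Λ \ ℝ³` -/

/-- The linear form `x ↦ π i ⟨k, x⟩`. -/
def phase (k : Fin 3 → ℤ) : E 3 →L[ℝ] ℂ :=
  ∑ i, (EuclideanSpace.proj i : E 3 →L[ℝ] ℝ).smulRight (Real.pi * k i * Complex.I : ℂ)

theorem phase_apply (k : Fin 3 → ℤ) (x : E 3) :
    phase k x = ∑ i, (x i : ℂ) * (Real.pi * k i * Complex.I) := by
  simp [phase]

theorem phase_single (k : Fin 3 → ℤ) (i : Fin 3) :
    phase k (EuclideanSpace.single i 1) = Real.pi * k i * Complex.I := by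
  rw [phase_apply, Finset.sum_eq_single i]
  · simp
  · intro j _ hj; simp [hj]
  · simp

/-- The plane wave `x ↦ exp (π i ⟨k, x⟩)`. -/
def wave (k : Fin 3 → ℤ) (x : E 3) : ℂ := Complex.exp (phase k x)

/-- The squared Euclidean length of the frequency `k`, as an integer. -/
def normSq (k : Fin 3 → ℤ) : ℤ := ∑ i, k i ^ 2

theorem hasFDerivAt_wave (k : Fin 3 → ℤ) (x : E 3) :
    HasFDerivAt (wave k) (wave k x • phase k) x :=
  (phase k).hasFDerivAt.cexp

theorem contDiff_wave (k : Fin 3 → ℤ) : ContDiff ℝ ∞ (wave k) := (phase k).contDiff.cexp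

theorem wave_add_of_mem (k : Fin 3 → ℤ) (x : E 3) {v : E 3} (hv : v ∈ lattice) :
    wave k (x + v) = wave k x := by
  choose m hm using hv
  rw [wave, wave, map_add, Complex.exp_add]
  have : phase k v = ((∑ i, m i * k i : ℤ) : ℂ) * (2 * Real.pi * Complex.I) := by
    rw [phase_apply]
    push_cast
    rw [Finset.sum_mul]
    refine Finset.sum_congr rfl fun i _ => ?_
    rw [hm i]; push_cast; ring
  rw [this, Complex.exp_int_mul_two_pi_mul_I, mul_one]

theorem laplacian_apply {n : ℕ} {F : Type*} [NormedAddCommGroup F] [NormedSpace ℝ F]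
    (f : E n → F) (x : E n) : Laplacian.laplacian f x =
      ∑ i, fderiv ℝ (fderiv ℝ f) x (EuclideanSpace.single i 1) (EuclideanSpace.single i 1) := by
  rw [InnerProductSpace.laplacian_eq_iteratedFDeriv_orthonormalBasis f
    (EuclideanSpace.basisFun (Fin n) ℝ)]
  simp [iteratedFDeriv_two_apply]

theorem sum_phase_single_sq (k : Fin 3 → ℤ) :
    ∑ i, phase k (EuclideanSpace.single i 1) ^ 2 = -(Real.pi ^ 2 * normSq k : ℂ) := by
  simp only [phase_single, normSq, mul_pow, Complex.I_sq]
  push_cast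
  rw [Finset.mul_sum, ← Finset.sum_neg_distrib]
  exact Finset.sum_congr rfl fun i _ => by ring

theorem laplacian_wave (k : Fin 3 → ℤ) (x : E 3) :
    Laplacian.laplacian (wave k) x = -(Real.pi ^ 2 * normSq k : ℂ) * wave k x := by
  have h1 : fderiv ℝ (wave k) = fun x => wave k x • phase k :=
    funext fun x => (hasFDerivAt_wave k x).fderiv
  have h2 : HasFDerivAt (fun x => wave k x • phase k)
      ((wave k x • phase k).smulRight (phase k)) x :=
    (hasFDerivAt_wave k x).smul_const (phase k)
  rw [laplacian_apply, h1, h2.fderiv, ← sum_phase_single_sq, Finset.sum_mul]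
  refine Finset.sum_congr rfl fun i _ => ?_
  simp only [ContinuousLinearMap.smulRight_apply, smul_apply, smul_eq_mul]
  ring

/-- The linear parametrization `y ↦ 2 y` of `ℝ³`, which takes the standard lattice `ℤ³` to `Λ`. -/
def double : (Fin 3 → ℝ) →L[ℝ] E 3 :=
  (2 : ℝ) • ((EuclideanSpace.equiv (Fin 3) ℝ).symm : (Fin 3 → ℝ) →L[ℝ] E 3)

@[simp] theorem double_apply (y : Fin 3 → ℝ) (i : Fin 3) : double y i = 2 * y i := by
  simp [double]

theorem double_single (i : Fin 3) :
    double (Pi.single i 1) = (2 : ℝ) • EuclideanSpace.single i 1 := by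
  ext j; simp [Pi.single_apply]

theorem fderiv_add_of_periodic {f : E 3 → ℂ} {v : E 3} (h : ∀ x, f (x + v) = f x) (x : E 3) :
    fderiv ℝ f (x + v) = fderiv ℝ f x := by
  rw [← fderiv_comp_add_right, funext h]

/-- Green's formula on the torus: plane waves and eigenfunctions with different eigenvalues are
orthogonal. -/
theorem integral_wave_mul_eq_zero {f : E 3 → ℂ} {μ : ℝ} (hf : ContDiff ℝ ∞ f)
    (hper : ∀ v ∈ lattice, ∀ x, f (x + v) = f x)
    (hΔ : ∀ x, -(Laplacian.laplacian f) x = (μ : ℂ) * f x) (k : Fin 3 → ℤ)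
    (hk : Real.pi ^ 2 * normSq k ≠ μ) :
    ∫ y in Icc (0 : Fin 3 → ℝ) 1, wave k (double y) * f (double y) = 0 := by
  set c : Fin 3 → ℂ := fun i => phase k (EuclideanSpace.single i 1) with hc
  -- the vector field `e_k ∇f - f ∇e_k`
  set H : E 3 → Fin 3 → ℂ := fun x i =>
    wave k x * (fderiv ℝ f x (EuclideanSpace.single i 1) - c i * f x) with hH
  have hf1 : ContDiff ℝ ∞ (fderiv ℝ f) := hf.fderiv_right (by simp)
  set H' : E 3 → E 3 →L[ℝ] (Fin 3 → ℂ) := fun x => ContinuousLinearMap.pi fun i =>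
    wave k x • ((fderiv ℝ (fderiv ℝ f) x).flip (EuclideanSpace.single i 1) - c i • fderiv ℝ f x) +
      (fderiv ℝ f x (EuclideanSpace.single i 1) - c i * f x) • (wave k x • phase k) with hH'
  have hderiv : ∀ x, HasFDerivAt H (H' x) x := fun x => by
    refine hasFDerivAt_pi.2 fun i => (hasFDerivAt_wave k x).mul (HasFDerivAt.sub ?_ ?_)
    · have := ((hf1.differentiable (by simp)) x).hasFDerivAt.clm_apply
        (hasFDerivAt_const (EuclideanSpace.single i (1 : ℝ)) x)
      simpa using this
    · exact ((hf.differentiable (by simp)) x).hasFDerivAt.const_mul (c i)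
  have hdiv : ∀ x, ∑ i, H' x (EuclideanSpace.single i 1) i =
      (Real.pi ^ 2 * normSq k - μ) * (wave k x * f x) := fun x => by
    have h1 : Laplacian.laplacian f x = -(μ * f x) := by rw [← hΔ, neg_neg]
    have h2 := sum_phase_single_sq k
    rw [laplacian_apply] at h1
    calc _ = wave k x * ∑ i, fderiv ℝ (fderiv ℝ f) x (EuclideanSpace.single i 1)
          (EuclideanSpace.single i 1) - (∑ i, c i ^ 2) * (wave k x * f x) := by
          rw [Finset.mul_sum, Finset.sum_mul, ← Finset.sum_sub_distrib]
          refine Finset.sum_congr rfl fun i _ => ?_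
          simp [hH', hc]
          ring
      _ = _ := by rw [h1, h2]; ring
  have hcont : Continuous fun y => wave k (double y) * f (double y) :=
    ((contDiff_wave k).continuous.comp double.continuous).mul
      (hf.continuous.comp double.continuous)
  have hdiv2 : ∀ y, ∑ i, (H' (double y)).comp double (Pi.single i 1) i =
      2 * ((Real.pi ^ 2 * normSq k - μ) * (wave k (double y) * f (double y))) := fun y => by
    rw [← hdiv, Finset.mul_sum]
    refine Finset.sum_congr rfl fun i _ => ?_
    rw [ContinuousLinearMap.comp_apply, double_single, map_smul, Pi.smul_apply, Complex.real_smul]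
    norm_num
  have hHper : ∀ v ∈ lattice, ∀ x, H (x + v) = H x := fun v hv x => by
    simp only [hH, wave_add_of_mem k x hv, fderiv_add_of_periodic (hper v hv), hper v hv]
  have key := MeasureTheory.integral_divergence_of_hasFDerivAt_off_countable
    (0 : Fin 3 → ℝ) 1 (by simp) (fun y => H (double y)) (fun y => (H' (double y)).comp double) ∅
    countable_empty
    (fun y _ => ((hderiv (double y)).comp y double.hasFDerivAt).continuousAt.continuousWithinAt)
    (fun y _ => (hderiv (double y)).comp y double.hasFDerivAt)
    (by
      simp only [hdiv2]
      exact ((hcont.const_mul _).const_mul _).continuousOn.integrableOn_compact isCompact_Icc)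
  -- the integrals over opposite faces cancel
  have hface : ∀ (i : Fin 3) (z : Fin 2 → ℝ), H (double (i.insertNth ((1 : Fin 3 → ℝ) i) z)) i =
      H (double (i.insertNth ((0 : Fin 3 → ℝ) i) z)) i := fun i z => by
    rw [← hHper (EuclideanSpace.single i 2) (fun j => ?_)
      (double (i.insertNth ((0 : Fin 3 → ℝ) i) z))]
    · congr 2
      ext j
      refine Fin.succAboveCases i ?_ (fun j => ?_) j
      · simp
      · simp [Fin.succAbove_ne]
    · by_cases h : j = i
      · exact ⟨1, by simp [h]⟩
      · exact ⟨0, by simp [h]⟩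
  simp only [hface, sub_self, Finset.sum_const_zero, hdiv2] at key
  rw [MeasureTheory.integral_const_mul, MeasureTheory.integral_const_mul] at key
  have hne : (Real.pi ^ 2 * normSq k - μ : ℂ) ≠ 0 := by
    rw [sub_ne_zero]; exact_mod_cast hk
  simpa [hne] using key

/-- The universal covering of the torus is a quotient map, so periodic functions descend. -/
theorem isOpenQuotientMap_torus :
    IsOpenQuotientMap (fun (y : Fin 3 → ℝ) i => (y i : UnitAddCircle)) :=
  IsOpenQuotientMap.piMap fun _ => QuotientAddGroup.isOpenQuotientMap_mk

theorem mFourier_coe (k : Fin 3 → ℤ) (y : Fin 3 → ℝ) :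
    UnitAddTorus.mFourier k (fun i => (y i : UnitAddCircle)) = wave k (double y) := by
  simp only [UnitAddTorus.mFourier, ContinuousMap.coe_mk, fourier_coe_apply]
  rw [wave, phase_apply, ← Complex.exp_sum]
  congr 1
  refine Finset.sum_congr rfl fun i _ => ?_
  simp only [double_apply]
  push_cast
  ring

/-- The frequencies of the plane waves with eigenvalue `μ`. -/
abbrev Freq (μ : ℝ) : Type := {k : Fin 3 → ℤ // Real.pi ^ 2 * normSq k = μ}

instance (μ : ℝ) : Finite (Freq μ) := by
  set R := ⌈μ / Real.pi ^ 2⌉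
  refine Set.Finite.to_subtype ((Set.finite_Icc (fun _ : Fin 3 => -R) (fun _ => R)).subset ?_)
  intro k hk
  have hk : Real.pi ^ 2 * normSq k = μ := hk
  have h1 : (normSq k : ℝ) ≤ R := by
    refine le_trans (le_of_eq ?_) (Int.le_ceil _)
    rw [← hk, mul_div_cancel_left₀]
    positivity
  have h2 : normSq k ≤ R := by exact_mod_cast h1
  have h3 : ∀ i, |k i| ≤ R := fun i => by
    have h4 : k i ^ 2 ≤ normSq k :=
      Finset.single_le_sum (f := fun i => k i ^ 2) (fun j _ => sq_nonneg _) (Finset.mem_univ i)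
    have h5 : |k i| ≤ k i ^ 2 := by rw [← sq_abs]; exact Int.le_self_sq _
    omega
  exact ⟨fun i => (abs_le.1 (h3 i)).1, fun i => (abs_le.1 (h3 i)).2⟩

instance (μ : ℝ) : Fintype (Freq μ) := Fintype.ofFinite _

/-- An eigenfunction on the torus `Λ \ ℝ³` is a combination of plane waves. -/
theorem exists_eq_sum_wave {f : E 3 → ℂ} {μ : ℝ} (hf : ContDiff ℝ ∞ f)
    (hper : ∀ v ∈ lattice, ∀ x, f (x + v) = f x)
    (hΔ : ∀ x, -(Laplacian.laplacian f) x = (μ : ℂ) * f x) :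
    ∃ c : Freq μ → ℂ, f = fun x => ∑ k, c k * wave k.1 x := by
  set π : C(Fin 3 → ℝ, UnitAddTorus (Fin 3)) := ⟨_, isOpenQuotientMap_torus.continuous⟩
  have hπ : Topology.IsQuotientMap π := isOpenQuotientMap_torus.isQuotientMap
  set F : C(Fin 3 → ℝ, ℂ) := ⟨fun y => f (double y), hf.continuous.comp double.continuous⟩
  have hF : ∀ y z, π y = π z → F y = F z := fun y z h => by
      have : ∀ i, ∃ m : ℤ, y i - z i = m := fun i => by
        have : (y i : UnitAddCircle) = z i := congrFun h i
        rw [← sub_eq_zero, ← AddCircle.coe_sub, AddCircle.coe_eq_zero_iff] at this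
        obtain ⟨m, hm⟩ := this
        exact ⟨m, by simpa using hm.symm⟩
      change f (double y) = f (double z)
      rw [← hper (double y - double z) (fun i => ?_) (double z), add_sub_cancel]
      obtain ⟨m, hm⟩ := this i
      exact ⟨m, by rw [← hm]; simp; ring⟩
  set g : C(UnitAddTorus (Fin 3), ℂ) := hπ.lift F hF
  have hgy : ∀ y : Fin 3 → ℝ, g (fun i => (y i : UnitAddCircle)) = f (double y) := fun y =>
    DFunLike.congr_fun (hπ.lift_comp F hF) y
  have hcoeff : ∀ k, Real.pi ^ 2 * normSq k ≠ μ → UnitAddTorus.mFourierCoeff g k = 0 := by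
    intro k hk
    rw [UnitAddTorus.mFourierCoeff_eq_integral _ _ 0]
    have hset : {x : Fin 3 → ℝ | ∀ i, x i ∈ Ioc ((0 : Fin 3 → ℝ) i) ((0 : Fin 3 → ℝ) i + 1)}
        =ᵐ[MeasureTheory.volume] Icc (0 : Fin 3 → ℝ) 1 := by
      have h : {x : Fin 3 → ℝ | ∀ i, x i ∈ Ioc ((0 : Fin 3 → ℝ) i) ((0 : Fin 3 → ℝ) i + 1)} =
          univ.pi fun i => Ioc ((0 : Fin 3 → ℝ) i) ((1 : Fin 3 → ℝ) i) := by
        ext x; simp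
      rw [h]
      exact MeasureTheory.Measure.univ_pi_Ioc_ae_eq_Icc
    rw [MeasureTheory.setIntegral_congr_set hset]
    simp only [hgy, mFourier_coe, smul_eq_mul]
    refine integral_wave_mul_eq_zero hf hper hΔ (-k) ?_
    simpa [normSq] using hk
  refine ⟨fun k => UnitAddTorus.mFourierCoeff g k.1, funext fun x => ?_⟩
  have hsupp : ∀ k ∉ (Finset.univ : Finset (Freq μ)).map (Function.Embedding.subtype _),
      UnitAddTorus.mFourierCoeff g k = 0 := fun k hk => by
    refine hcoeff k fun h => hk ?_
    exact Finset.mem_map.2 ⟨⟨k, h⟩, Finset.mem_univ _, rfl⟩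
  have hsum := UnitAddTorus.hasSum_mFourier_series_apply_of_summable
    (summable_of_ne_finset_zero hsupp) (fun i => ((x i / 2 : ℝ) : UnitAddCircle))
  have hx : double (fun i => x i / 2) = x := by ext i; simp; ring
  rw [hgy fun i => x i / 2, hx] at hsum
  have hsum' := hasSum_sum_of_ne_finset_zero (L := SummationFilter.unconditional _)
    (f := fun k => UnitAddTorus.mFourierCoeff g k •
      UnitAddTorus.mFourier k (fun i => ((x i / 2 : ℝ) : UnitAddCircle)))
    (fun k hk => by rw [hsupp k hk, zero_smul])
  rw [hsum.unique hsum', Finset.sum_map]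
  refine Finset.sum_congr rfl fun k _ => ?_
  rw [mFourier_coe _ fun i => x i / 2, hx]
  rfl

/-! ### Isospectrality on functions -/

theorem wave_injective : Function.Injective wave := fun k l h => by
  funext i
  have h0 := congrFun h 0
  have h1 : fderiv ℝ (wave k) 0 (EuclideanSpace.single i 1) =
      fderiv ℝ (wave l) 0 (EuclideanSpace.single i 1) := by rw [h]
  rw [(hasFDerivAt_wave k 0).fderiv, (hasFDerivAt_wave l 0).fderiv] at h1
  simp only [wave, map_zero, Complex.exp_zero, one_smul, phase_single] at h1
  have hpi : (Real.pi : ℂ) ≠ 0 := by exact_mod_cast Real.pi_pos.ne'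
  have h2 := mul_left_cancel₀ hpi (mul_right_cancel₀ Complex.I_ne_zero h1)
  exact_mod_cast h2

/-- Plane waves are distinct characters of `ℝ³`, hence linearly independent. -/
theorem linearIndependent_wave : LinearIndependent ℂ wave := by
  set φ : (Fin 3 → ℤ) → (Multiplicative (E 3) →* ℂ) := fun k =>
    { toFun := fun x => wave k x.toAdd
      map_one' := by simp [wave]
      map_mul' := fun x y => by simp [wave, Complex.exp_add] } with hφ
  have hφi : Function.Injective φ := fun k l h =>
    wave_injective (funext fun x => DFunLike.congr_fun h (Multiplicative.ofAdd x))
  have := (linearIndependent_monoidHom (Multiplicative (E 3)) ℂ).comp φ hφi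
  exact this

/-- The linear combination of plane waves with given coefficients. -/
def synth (μ : ℝ) : (Freq μ → ℂ) →ₗ[ℂ] (E 3 → ℂ) :=
  Fintype.linearCombination ℂ fun k : Freq μ => wave k.1

theorem synth_apply {μ : ℝ} (c : Freq μ → ℂ) (x : E 3) :
    synth μ c x = ∑ k, c k * wave k.1 x := by
  simp [synth, Fintype.linearCombination_apply]

theorem synth_injective (μ : ℝ) : Function.Injective (synth μ) :=
  linearIndependent_iff_injective_fintypeLinearCombination.1
    (linearIndependent_wave.comp (Subtype.val : Freq μ → _) Subtype.val_injective)

/-- The isometry `ρ` permutes the plane waves with eigenvalue `μ` by `σ`. -/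
def ActsBy {μ : ℝ} (ρ : Isom 3) (σ : Equiv.Perm (Freq μ)) : Prop :=
  ∀ k x, wave k.1 (ρ x) = wave (σ k).1 x

theorem synth_comp {μ : ℝ} {ρ : Isom 3} {σ : Equiv.Perm (Freq μ)} (h : ActsBy ρ σ)
    (c : Freq μ → ℂ) (x : E 3) : synth μ c (ρ x) = synth μ (c ∘ σ.symm) x := by
  rw [synth_apply, synth_apply,
    ← Equiv.sum_comp σ fun k => (c ∘ σ.symm) k * wave k.1 x]
  exact Finset.sum_congr rfl fun k _ => by rw [h k x]; simp

theorem isPointGroup_bot : IsPointGroup ⊥ lattice where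
  apply_zero := by rintro _ rfl; rfl
  apply_mem := by rintro _ rfl v hv; exact hv

theorem wave_mem_eigenfunctions {μ : ℝ} (k : Freq μ) :
    wave k.1 ∈ eigenfunctions (semidirect isPointGroup_bot) μ := by
  refine ⟨contDiff_wave _, ?_, fun x => ?_⟩
  · rintro _ ⟨ρ, rfl, v, hv, rfl⟩ x
    rw [one_mul, transl_apply, wave_add_of_mem _ _ hv]
  · rw [laplacian_wave, neg_mul, neg_neg]
    congr 1
    exact_mod_cast k.2

/-- The eigenfunctions on `(P ⋉ Λ) \ ℝ³` are the `P`-invariant combinations of plane waves. -/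
theorem mem_eigenfunctions_iff {μ : ℝ} {P : Subgroup (Isom 3)} (hP : IsPointGroup P lattice)
    {f : E 3 → ℂ} : f ∈ eigenfunctions (semidirect hP) μ ↔
      ∃ c, f = synth μ c ∧ ∀ ρ ∈ P, ∀ x, synth μ c (ρ x) = synth μ c x := by
  constructor
  · rintro ⟨hf, hinv, hΔ⟩
    have hper : ∀ v ∈ lattice, ∀ x, f (x + v) = f x := fun v hv x => by
      rw [← hinv (transl v) ⟨1, P.one_mem, v, hv, (one_mul _).symm⟩ x, transl_apply]
    obtain ⟨c, rfl⟩ := exists_eq_sum_wave hf hper hΔ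
    have hc : synth μ c = fun x => ∑ k, c k * wave k.1 x := funext (synth_apply c)
    refine ⟨c, hc.symm, fun ρ hρ x => ?_⟩
    rw [hc]
    exact hinv ρ ⟨ρ, hρ, 0, lattice.zero_mem, by rw [transl_zero, mul_one]⟩ x
  · rintro ⟨c, rfl, hc⟩
    have hmem : synth μ c ∈ eigenfunctions (semidirect isPointGroup_bot) μ := by
      rw [synth, Fintype.linearCombination_apply]
      exact Submodule.sum_mem _ fun k _ => Submodule.smul_mem _ _ (wave_mem_eigenfunctions k)
    refine ⟨hmem.1, ?_, hmem.2.2⟩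
    rintro _ ⟨ρ, hρ, v, hv, rfl⟩ x
    rw [mul_apply, hc ρ hρ]
    exact hmem.2.1 (transl v) ⟨1, Subgroup.one_mem _, v, hv, (one_mul _).symm⟩ x

/-- The trace of a permutation operator is the number of fixed points. -/
theorem trace_funLeft {ι : Type*} [Fintype ι] (σ : Equiv.Perm ι) :
    LinearMap.trace ℂ (ι → ℂ) (LinearMap.funLeft ℂ ℂ σ) = (Function.fixedPoints σ).ncard := by
  classical
  rw [← Matrix.trace_permutation (R := ℂ), LinearMap.trace_eq_matrix_trace ℂ (Pi.basisFun ℂ ι)]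
  congr 1
  ext i j
  simp [Equiv.Perm.permMatrix, PEquiv.toMatrix_apply, Pi.single_apply,
    eq_comm]

/-- The number of plane waves with eigenvalue `μ` that are fixed by `ρ`. -/
def fixedCount (μ : ℝ) (ρ : Isom 3) : ℕ := {k : Freq μ | ∀ x, wave k.1 (ρ x) = wave k.1 x}.ncard

/-- The multiplicity of an eigenvalue on functions: the projection onto the invariants is the
average of the permutations of the plane waves, and its trace counts fixed plane waves. -/
theorem rank_eigenfunctions {μ : ℝ} {P : Subgroup (Isom 3)} [Fintype P]
    (hP : IsPointGroup P lattice) (hσ : ∀ ρ ∈ P, ∃ σ : Equiv.Perm (Freq μ), ActsBy ρ σ) :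
    ∃ N : ℕ, Module.rank ℂ (eigenfunctions (semidirect hP) μ) = N ∧
      Fintype.card P * N = ∑ ρ : P, fixedCount μ ρ := by
  choose σ hσ using fun ρ : P => hσ ρ.1 ρ.2
  -- pullback is contravariant
  have hmul : ∀ ρ τ : P, σ (ρ * τ) = σ τ * σ ρ := fun ρ τ => by
    ext1 k
    refine Subtype.ext (wave_injective (funext fun x => ?_))
    rw [← hσ]
    change wave k.1 (ρ.1 (τ.1 x)) = wave (σ τ (σ ρ k)).1 x
    rw [hσ ρ, hσ τ]
  -- `T ρ` is pullback by `ρ`, in terms of coefficients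
  set T : P → (Freq μ → ℂ) →ₗ[ℂ] (Freq μ → ℂ) := fun ρ => LinearMap.funLeft ℂ ℂ (σ ρ).symm with hT
  have hTsynth : ∀ ρ c x, synth μ c (ρ.1 x) = synth μ (T ρ c) x := fun ρ c x =>
    synth_comp (hσ ρ) c x
  have hTmul : ∀ ρ τ c, T τ (T ρ c) = T (ρ * τ) c := fun ρ τ c => by
    funext k
    simp [hT, hmul, LinearMap.funLeft_apply, Equiv.Perm.mul_def]
  set I : Submodule ℂ (Freq μ → ℂ) :=
    { carrier := {c | ∀ ρ, T ρ c = c}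
      zero_mem' := fun ρ => map_zero _
      add_mem' := fun {c d} hc hd ρ => by rw [map_add, hc ρ, hd ρ]
      smul_mem' := fun a c hc ρ => by rw [map_smul, hc ρ] } with hI
  have hmap : eigenfunctions (semidirect hP) μ = I.map (synth μ) := by
    ext f
    rw [mem_eigenfunctions_iff hP, Submodule.mem_map]
    constructor
    · rintro ⟨c, rfl, hc⟩
      refine ⟨c, fun ρ => synth_injective μ (funext fun x => ?_), rfl⟩
      rw [← hTsynth, hc ρ.1 ρ.2]
    · rintro ⟨c, hc, rfl⟩
      refine ⟨c, rfl, fun ρ hρ x => ?_⟩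
      rw [hTsynth ⟨ρ, hρ⟩, hc ⟨ρ, hρ⟩]
  have hcard : (Fintype.card P : ℂ) ≠ 0 := by exact_mod_cast Fintype.card_ne_zero
  have hproj : LinearMap.IsProj I ((Fintype.card P : ℂ)⁻¹ • ∑ ρ, T ρ) := by
    constructor
    · intro c τ
      simp only [LinearMap.smul_apply, map_smul, LinearMap.sum_apply, map_sum, hTmul]
      congr 1
      exact Fintype.sum_equiv (Equiv.mulRight τ) _ _ fun _ => rfl
    · intro c hc
      have : ∀ ρ, T ρ c = c := hc
      simp only [LinearMap.smul_apply, LinearMap.sum_apply, this, Finset.sum_const,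
        Finset.card_univ]
      rw [← Nat.cast_smul_eq_nsmul ℂ, smul_smul, inv_mul_cancel₀ hcard, one_smul]
  refine ⟨Module.finrank ℂ I, ?_, ?_⟩
  · rw [hmap, Module.finrank_eq_rank]
    exact (Submodule.equivMapOfInjective _ (synth_injective μ) I).rank_eq.symm
  · have := hproj.trace
    rw [map_smul, map_sum, smul_eq_mul, inv_mul_eq_iff_eq_mul₀ hcard] at this
    have h2 : ∀ ρ : P, LinearMap.trace ℂ _ (T ρ) = fixedCount μ ρ := fun ρ => by
      rw [hT, trace_funLeft, fixedCount]
      congr 2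
      ext k
      change (σ ρ).symm k = k ↔ ∀ x, _
      rw [Equiv.symm_apply_eq, eq_comm, Subtype.ext_iff, ← wave_injective.eq_iff, funext_iff]
      exact forall_congr' fun x => by rw [hσ]
    simp only [h2] at this
    exact_mod_cast this.symm

theorem actsBy_one {μ : ℝ} : ActsBy (μ := μ) 1 1 := fun _ _ => rfl

theorem ActsBy.mul {μ : ℝ} {ρ ρ' : Isom 3} {σ σ' : Equiv.Perm (Freq μ)} (h : ActsBy ρ σ)
    (h' : ActsBy ρ' σ') : ActsBy (ρ * ρ') (σ' * σ) := fun k x => by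
  rw [mul_apply, h, h']; rfl

/-- A permutation of the frequencies given by a bijection of `ℤ³` which preserves `|k|²`. -/
def freqPerm (μ : ℝ) (e : Equiv.Perm (Fin 3 → ℤ)) (h : ∀ k, normSq (e k) = normSq k) :
    Equiv.Perm (Freq μ) :=
  e.subtypePerm fun k => by rw [h]

theorem wave_tau (k : Fin 3 → ℤ) (x : E 3) : wave k (tau x) = wave ![k 1, -k 0, k 2] x := by
  rw [wave, wave, phase_apply, phase_apply]
  congr 1
  simp [Fin.sum_univ_three]
  ring

theorem wave_chi1 (k : Fin 3 → ℤ) (x : E 3) : wave k (chi1 x) = wave ![k 0, -k 1, -k 2] x := by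
  rw [wave, wave, phase_apply, phase_apply]
  congr 1
  simp [Fin.sum_univ_three]

theorem wave_chi2 (k : Fin 3 → ℤ) (x : E 3) : wave k (chi2 x) = wave ![-k 0, k 1, -k 2] x := by
  rw [wave, wave, phase_apply, phase_apply]
  congr 1
  simp [Fin.sum_univ_three]

theorem wave_chi3 (k : Fin 3 → ℤ) (x : E 3) : wave k (chi3 x) = wave ![-k 0, -k 1, k 2] x := by
  rw [wave, wave, phase_apply, phase_apply]
  congr 1
  simp [Fin.sum_univ_three]

theorem fun_fin3_ext {α : Type*} {f g : Fin 3 → α} (h0 : f 0 = g 0) (h1 : f 1 = g 1)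
    (h2 : f 2 = g 2) : f = g := by
  funext i; fin_cases i
  exacts [h0, h1, h2]

theorem exists_actsBy_tau (μ : ℝ) : ∃ σ : Equiv.Perm (Freq μ), ActsBy tau σ :=
  ⟨freqPerm μ ⟨fun k => ![k 1, -k 0, k 2], fun k => ![-k 1, k 0, k 2],
    fun k => fun_fin3_ext (by simp) (by simp) (by simp),
    fun k => fun_fin3_ext (by simp) (by simp) (by simp)⟩
    fun k => by simp [normSq, Fin.sum_univ_three, add_comm], fun k x => wave_tau k.1 x⟩

theorem exists_actsBy_chi1 (μ : ℝ) : ∃ σ : Equiv.Perm (Freq μ), ActsBy chi1 σ :=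
  ⟨freqPerm μ ⟨fun k => ![k 0, -k 1, -k 2], fun k => ![k 0, -k 1, -k 2],
    fun k => fun_fin3_ext (by simp) (by simp) (by simp),
    fun k => fun_fin3_ext (by simp) (by simp) (by simp)⟩
    fun k => by simp [normSq, Fin.sum_univ_three], fun k x => wave_chi1 k.1 x⟩

theorem exists_actsBy_chi3 (μ : ℝ) : ∃ σ : Equiv.Perm (Freq μ), ActsBy chi3 σ := by
  obtain ⟨σ, h⟩ := exists_actsBy_tau μ
  exact ⟨_, by rw [← tau_sq, pow_two]; exact h.mul h⟩

theorem exists_actsBy_chi2 (μ : ℝ) : ∃ σ : Equiv.Perm (Freq μ), ActsBy chi2 σ := by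
  obtain ⟨σ, h⟩ := exists_actsBy_chi1 μ
  obtain ⟨σ', h'⟩ := exists_actsBy_chi3 μ
  exact ⟨_, by rw [← chi_mul.2.2.2.2.2.1]; exact h.mul h'⟩

/-- The number of plane waves with eigenvalue `μ` whose wave vector lies on the coordinate axis
with index `i`. -/
def axisCount (μ : ℝ) (i : Fin 3) : ℕ := {k : Freq μ | ∀ j, j ≠ i → k.1 j = 0}.ncard

/-- The three coordinate axes carry equally many plane waves of each eigenvalue. This coincidence is
what makes the two orbifolds isospectral on functions. -/
theorem axisCount_eq (μ : ℝ) (i : Fin 3) : axisCount μ i = axisCount μ 2 := by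
  set s := Equiv.swap i 2
  set e := freqPerm μ (Equiv.arrowCongr s (Equiv.refl ℤ))
    fun k => Equiv.sum_comp s.symm fun j => k j ^ 2
  have he : {k : Freq μ | ∀ j, j ≠ i → k.1 j = 0} =
      e ⁻¹' {k : Freq μ | ∀ j, j ≠ 2 → k.1 j = 0} := by
    ext k
    change (∀ j, j ≠ i → k.1 j = 0) ↔ ∀ j, j ≠ 2 → k.1 (s.symm j) = 0
    refine s.forall_congr fun j => ?_
    rw [Equiv.symm_apply_apply, Ne, Ne, ← s.apply_eq_iff_eq (x := j) (y := i),
      Equiv.swap_apply_left]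
  rw [axisCount, he, Set.ncard_preimage_of_injective_subset_range e.injective
    (by rw [e.surjective.range_eq]; exact subset_univ _), axisCount]

/-- If `ρ` takes the plane wave of frequency `k` to that of frequency `g k`, and the fixed points of
`g` form the `i`-th axis, then `ρ` fixes just the plane waves on that axis. -/
theorem fixedCount_eq {μ : ℝ} {ρ : Isom 3} {g : (Fin 3 → ℤ) → Fin 3 → ℤ}
    (h : ∀ k x, wave k (ρ x) = wave (g k) x) (i : Fin 3)
    (hg : ∀ k, g k = k ↔ ∀ j, j ≠ i → k j = 0) : fixedCount μ ρ = axisCount μ i := by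
  rw [fixedCount, axisCount]
  congr 1
  ext k
  change (∀ x, _) ↔ ∀ j, j ≠ i → k.1 j = 0
  rw [← hg, ← wave_injective.eq_iff, funext_iff]
  exact forall_congr' fun x => by rw [h]

theorem vec_eq_iff {a b c : ℤ} {k : Fin 3 → ℤ} :
    ![a, b, c] = k ↔ a = k 0 ∧ b = k 1 ∧ c = k 2 := by
  constructor
  · rintro rfl; simp
  · rintro ⟨h0, h1, h2⟩; exact fun_fin3_ext h0 h1 h2

theorem fixedCount_tau (μ : ℝ) : fixedCount μ tau = axisCount μ 2 :=
  fixedCount_eq wave_tau 2 fun k => by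
    rw [vec_eq_iff, Fin.forall_fin_succ, Fin.forall_fin_two]; simp; omega

theorem fixedCount_chi1 (μ : ℝ) : fixedCount μ chi1 = axisCount μ 0 :=
  fixedCount_eq wave_chi1 0 fun k => by
    rw [vec_eq_iff, Fin.forall_fin_succ, Fin.forall_fin_two]; simp; omega

theorem fixedCount_chi2 (μ : ℝ) : fixedCount μ chi2 = axisCount μ 1 :=
  fixedCount_eq wave_chi2 1 fun k => by
    rw [vec_eq_iff, Fin.forall_fin_succ, Fin.forall_fin_two]; simp; omega

theorem fixedCount_chi3 (μ : ℝ) : fixedCount μ chi3 = axisCount μ 2 :=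
  fixedCount_eq wave_chi3 2 fun k => by
    rw [vec_eq_iff, Fin.forall_fin_succ, Fin.forall_fin_two]; simp; omega

theorem fixedCount_inv (μ : ℝ) (ρ : Isom 3) : fixedCount μ ρ⁻¹ = fixedCount μ ρ := by
  rw [fixedCount, fixedCount]
  congr 1
  ext k
  constructor
  · intro h x
    rw [← h (ρ x), ← mul_apply, inv_mul_cancel]; rfl
  · intro h x
    rw [← h (ρ⁻¹ x), ← mul_apply, mul_inv_cancel]; rfl

theorem isospectralOnFunctions : IsospectralOnFunctions Gam1 Gam2 := by
  classical
  intro μ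
  set s1 : Finset (Isom 3) := {1, tau, chi3, chi3 * tau} with hs1
  set s2 : Finset (Isom 3) := {1, chi1, chi2, chi3} with hs2
  have hm1 : ∀ ρ, ρ ∈ s1 ↔ ρ ∈ pointGroup1 := fun ρ => by simp [hs1, mem_pointGroup1']
  have hm2 : ∀ ρ, ρ ∈ s2 ↔ ρ ∈ pointGroup2 := fun ρ => by simp [hs2, mem_pointGroup2]
  let : Fintype pointGroup1 := Fintype.subtype s1 hm1
  let : Fintype pointGroup2 := Fintype.subtype s2 hm2
  obtain ⟨N1, h1, h1'⟩ := rank_eigenfunctions (μ := μ) isPointGroup1 fun ρ hρ => by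
    obtain ⟨σ, h⟩ := exists_actsBy_tau μ
    obtain ⟨σ', h'⟩ := exists_actsBy_chi3 μ
    rcases mem_pointGroup1'.1 hρ with rfl | rfl | rfl | rfl
    exacts [⟨_, actsBy_one⟩, ⟨_, h⟩, ⟨_, h'⟩, ⟨_, h'.mul h⟩]
  obtain ⟨N2, h2, h2'⟩ := rank_eigenfunctions (μ := μ) isPointGroup2 fun ρ hρ => by
    rcases mem_pointGroup2.1 hρ with rfl | rfl | rfl | rfl
    exacts [⟨_, actsBy_one⟩, exists_actsBy_chi1 μ, exists_actsBy_chi2 μ, exists_actsBy_chi3 μ]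
  have hc1 : Fintype.card pointGroup1 = 4 := by
    rw [← Nat.card_eq_fintype_card, Nat.card_zpowers, orderOf_tau]
  have hc2 : Fintype.card pointGroup2 = 4 := by
    rw [← Nat.card_eq_fintype_card, IsKleinFour.card_four]
  have hs1' : s1.card = 4 := by rw [← hc1]; exact (Fintype.card_of_subtype s1 hm1).symm
  have hs2' : s2.card = 4 := by rw [← hc2]; exact (Fintype.card_of_subtype s2 hm2).symm
  rw [← Finset.sum_subtype s1 hm1 (fixedCount μ), hc1] at h1'
  rw [← Finset.sum_subtype s2 hm2 (fixedCount μ), hc2] at h2'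
  -- four elements listed without repetition, as the cardinality shows
  have hsum : ∀ a b c d : Isom 3, ({a, b, c, d} : Finset (Isom 3)).card = 4 →
      ∑ ρ ∈ ({a, b, c, d} : Finset (Isom 3)), fixedCount μ ρ =
        fixedCount μ a + (fixedCount μ b + (fixedCount μ c + fixedCount μ d)) := by
    intro a b c d h
    have hd : a ∉ ({b, c, d} : Finset (Isom 3)) ∧ b ∉ ({c, d} : Finset (Isom 3)) ∧
        c ∉ ({d} : Finset (Isom 3)) := by
      refine ⟨fun ha => ?_, fun hb => ?_, fun hc => ?_⟩
      · rw [Finset.insert_eq_of_mem ha] at h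
        have := Finset.card_le_three (a := b) (b := c) (c := d)
        omega
      · rw [Finset.insert_eq_of_mem hb] at h
        have := Finset.card_le_three (a := a) (b := c) (c := d)
        omega
      · rw [Finset.insert_eq_of_mem hc] at h
        have := Finset.card_le_three (a := a) (b := b) (c := d)
        omega
    rw [Finset.sum_insert hd.1, Finset.sum_insert hd.2.1, Finset.sum_insert hd.2.2,
      Finset.sum_singleton]
  rw [hsum _ _ _ _ hs1', fixedCount_tau, fixedCount_chi3, chi3_mul_tau, fixedCount_inv,
    fixedCount_tau] at h1'
  rw [hsum _ _ _ _ hs2', fixedCount_chi1, fixedCount_chi2, fixedCount_chi3, axisCount_eq μ 0,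
    axisCount_eq μ 1] at h2'
  rw [gam1_eq, gam2_eq, h1, h2, show N1 = N2 by omega]

/-! ### Harmonic 1-forms -/

theorem exists_eq_const {α : Type*} (m : Fin 1 → α) : ∃ v, m = fun _ => v :=
  ⟨m 0, funext fun j => by rw [Subsingleton.elim j 0]⟩

/-- Evaluation of a form on fixed vectors commutes with differentiation. -/
theorem fderiv_form_apply {n k : ℕ} {w : Form n k} {x : E n} (hw : DifferentiableAt ℝ w x)
    (u : E n) (m : Fin k → E n) : fderiv ℝ w x u m = fderiv ℝ (fun y => w y m) x u := by
  have := ((ContinuousAlternatingMap.apply ℝ (E n) ℂ m).hasFDerivAt.comp x hw.hasFDerivAt).fderiv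
  exact (DFunLike.congr_fun this u).symm

theorem contDiff_form_apply {n k : ℕ} {w : Form n k} (hw : ContDiff ℝ ∞ w) (m : Fin k → E n) :
    ContDiff ℝ ∞ fun x => w x m :=
  (ContinuousAlternatingMap.apply ℝ (E n) ℂ m).contDiff.comp hw

theorem fderiv_fderiv_apply {n : ℕ} {f : E n → ℂ} (hf : ContDiff ℝ ∞ f) (x u v : E n) :
    fderiv ℝ (fun y => fderiv ℝ f y u) x v = fderiv ℝ (fderiv ℝ f) x v u := by
  have h1 : ContDiff ℝ ∞ (fderiv ℝ f) := hf.fderiv_right (by simp)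
  rw [fderiv_clm_apply ((h1.differentiable (by simp)) x) (differentiableAt_const _)]
  simp

/-- On flat space the Laplace operator on `1`-forms acts componentwise. -/
theorem hodgeLaplacian_apply {n : ℕ} {w : Form n 1} (hw : ContDiff ℝ ∞ w) (x v : E n) :
    hodgeLaplacian w x (fun _ => v) = -Laplacian.laplacian (fun y => w y fun _ => v) x := by
  have hd : Differentiable ℝ w := hw.differentiable (by simp)
  have hW : ∀ u, ContDiff ℝ ∞ fun y => w y fun _ => u := fun u => contDiff_form_apply hw _
  have hW1 : ∀ u u' : E n, Differentiable ℝ fun y => fderiv ℝ (fun y => w y fun _ => u) y u' :=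
    fun u u' => (((hW u).fderiv_right (m := ∞) (by simp)).clm_apply contDiff_const).differentiable
      (by simp)
  have h1 : ∀ m, (fun y => codiff w y m) = fun y => -∑ i : Fin n,
      fderiv ℝ (fun y => w y fun _ => EuclideanSpace.single i 1) y (EuclideanSpace.single i 1) := by
    intro m
    funext y
    simp only [codiff, ContinuousAlternatingMap.neg_apply, ContinuousAlternatingMap.sum_apply,
      ContinuousAlternatingMap.curryLeft_apply_apply]
    congr 1
    refine Finset.sum_congr rfl fun i _ => ?_
    rw [fderiv_form_apply (hd y)]
    congr 3
    funext z
    congr 1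
    funext j
    simp [Subsingleton.elim j 0]
  have h2 : ∀ a, (fun y => extDeriv w y (Matrix.vecCons a fun _ => v)) = fun y =>
      fderiv ℝ (fun y => w y fun _ => v) y a - fderiv ℝ (fun y => w y fun _ => a) y v := by
    intro a
    funext y
    rw [extDeriv_apply (hd y), Fin.sum_univ_two]
    have e0 : (Fin.removeNth 0 (Matrix.vecCons a fun _ => v) : Fin 1 → E n) = fun _ => v := by
      funext j; simp [Fin.removeNth]
    have e1 : (Fin.removeNth 1 (Matrix.vecCons a fun _ => v) : Fin 1 → E n) = fun _ => a := by
      funext j; simp [Fin.removeNth, Subsingleton.elim j 0]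
    rw [e0, e1]
    simp [sub_eq_add_neg]
  have h3 : extDeriv (codiff w) x (fun _ => v) = -∑ i : Fin n,
      fderiv ℝ (fderiv ℝ fun y => w y fun _ => EuclideanSpace.single i 1) x v
        (EuclideanSpace.single i 1) := by
    rw [extDeriv_apply (((contDiff_codiff hw).differentiable (by simp)) x), Fin.sum_univ_one, h1,
      fderiv_fun_neg, fderiv_fun_sum fun i _ => (hW1 _ _) x]
    simp [fderiv_fderiv_apply (hW _)]
  have h4 : codiff (extDeriv w) x (fun _ => v) = -∑ i : Fin n,
      (fderiv ℝ (fderiv ℝ fun y => w y fun _ => v) x (EuclideanSpace.single i 1)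
        (EuclideanSpace.single i 1) -
      fderiv ℝ (fderiv ℝ fun y => w y fun _ => EuclideanSpace.single i 1) x
        (EuclideanSpace.single i 1) v) := by
    simp only [codiff, ContinuousAlternatingMap.neg_apply, ContinuousAlternatingMap.sum_apply,
      ContinuousAlternatingMap.curryLeft_apply_apply]
    congr 1
    refine Finset.sum_congr rfl fun i _ => ?_
    rw [fderiv_form_apply (((contDiff_extDeriv hw).differentiable (by simp)) x), h2,
      fderiv_fun_sub ((hW1 _ _) x) ((hW1 _ _) x), sub_apply,
      fderiv_fderiv_apply (hW _), fderiv_fderiv_apply (hW _)]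
  have hsymm : ∀ i, fderiv ℝ (fderiv ℝ fun y => w y fun _ => EuclideanSpace.single i 1) x v
      (EuclideanSpace.single i 1) = fderiv ℝ (fderiv ℝ fun y => w y fun _ =>
        EuclideanSpace.single i 1) x (EuclideanSpace.single i 1) v := fun i =>
    ((hW _).contDiffAt.isSymmSndFDerivAt (by simpa using two_le_infty)) v _
  rw [hodgeLaplacian, ContinuousAlternatingMap.add_apply, h3, h4, laplacian_apply]
  simp only [hsymm, Finset.sum_sub_distrib]
  ring

theorem fderiv_isom {n : ℕ} (γ : Isom n) (x u : E n) :
    fderiv ℝ γ x u = γ.linearIsometryEquiv u := by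
  have h : (γ : E n → E n) = fun y => γ.linearIsometryEquiv y + γ 0 := funext fun y => by
    simpa using γ.map_vadd 0 y
  have h2 : HasFDerivAt (fun y => γ.linearIsometryEquiv y + γ 0)
      (γ.linearIsometryEquiv.toContinuousLinearEquiv : E n →L[ℝ] E n) x :=
    γ.linearIsometryEquiv.toContinuousLinearEquiv.hasFDerivAt.add_const _
  rw [h, h2.fderiv]
  rfl

theorem fderiv_isom_eq_sub {n : ℕ} (γ : Isom n) (x u : E n) : fderiv ℝ γ x u = γ u - γ 0 := by
  rw [fderiv_isom, eq_sub_iff_add_eq]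
  simpa using (γ.map_vadd 0 u).symm

theorem formInvariant_apply {n : ℕ} {Γ : Subgroup (Isom n)} {w : Form n 1}
    (h : FormInvariant Γ w) {γ : Isom n} (hγ : γ ∈ Γ) (x u : E n) :
    w (γ x) (fun _ => γ u - γ 0) = w x fun _ => u := by
  rw [← h γ hγ x]
  simp [Function.comp_def, fderiv_isom_eq_sub]

/-- The constant form `dx₃`. -/
def dz : Form 3 1 := fun _ => ContinuousAlternatingMap.ofSubsingleton ℝ (E 3) ℂ 0
  (Complex.ofRealCLM.comp (EuclideanSpace.proj 2))

theorem dz_apply (x : E 3) (m : Fin 1 → E 3) : dz x m = (m 0 2 : ℂ) := rfl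

/-- All of `Γ₁` preserves `dx₃`, because `τ` is a rotation around the third axis. -/
theorem dz_mem_eigenforms : dz ∈ eigenforms 0 Gam1 0 := by
  refine ⟨contDiff_const, fun γ hγ x => ?_, fun x => ?_⟩
  · rw [gam1_eq] at hγ
    obtain ⟨ρ, hρ, v, -, rfl⟩ := hγ
    ext m
    rw [ContinuousAlternatingMap.compContinuousLinearMap_apply, dz_apply, dz_apply,
      Function.comp_apply, fderiv_isom_eq_sub]
    norm_cast
    rw [PiLp.sub_apply, mul_apply, mul_apply, transl_apply, transl_apply]
    rcases mem_pointGroup1'.1 hρ with rfl | rfl | rfl | rfl <;> simp [mul_apply, one_apply]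
  · ext m
    obtain ⟨v, rfl⟩ : ∃ v, m = fun _ => v := exists_eq_const m
    have h : ContDiff ℝ ∞ dz := contDiff_const
    have h2 : (fun y => dz y fun _ => v) = fun _ => (v 2 : ℂ) := rfl
    rw [hodgeLaplacian_apply h, h2, InnerProductSpace.laplacian_const]
    simp

theorem dz_ne_zero : dz ≠ 0 := fun h => by
  have := DFunLike.congr_fun (congrFun h 0) fun _ => EuclideanSpace.single 2 1
  rw [dz_apply] at this
  simp at this

/-- A harmonic function on the torus is constant. -/
theorem eq_of_harmonic {f : E 3 → ℂ} (hf : ContDiff ℝ ∞ f)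
    (hper : ∀ v ∈ lattice, ∀ x, f (x + v) = f x)
    (hΔ : ∀ x, Laplacian.laplacian f x = 0) (x y : E 3) : f x = f y := by
  obtain ⟨c, rfl⟩ := exists_eq_sum_wave (μ := 0) hf hper fun x => by simp [hΔ]
  refine Finset.sum_congr rfl fun k _ => ?_
  have hk : normSq k.1 = 0 := by
    have := k.2
    have hpi : Real.pi ^ 2 ≠ 0 := by positivity
    exact_mod_cast (mul_eq_zero.1 this).resolve_left hpi
  have hk0 : ∀ i, k.1 i = 0 := fun i => by
    have := (Finset.sum_eq_zero_iff_of_nonneg fun i _ => sq_nonneg (k.1 i)).1 hk i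
      (Finset.mem_univ i)
    exact pow_eq_zero_iff two_ne_zero |>.1 this
  simp [wave, phase_apply, hk0]

/-- There are no nonzero harmonic `1`-forms on `Γ₂ \ ℝ³`: their components would be constant and
invariant under the point group of `Γ₂`, whose four elements add up to zero as linear maps. -/
theorem eigenforms_gam2_eq_bot : eigenforms 0 Gam2 0 = ⊥ := by
  rw [eq_bot_iff]
  rintro w ⟨hw, hinv, hΔ⟩
  rw [gam2_eq] at hinv
  have hconst : ∀ v x y, (w x fun _ => v) = w y fun _ => v := fun v => by
    refine eq_of_harmonic (contDiff_form_apply hw _) (fun u hu x => ?_) (fun x => ?_)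
    · have := formInvariant_apply hinv (γ := transl u)
        ⟨1, Subgroup.one_mem _, u, hu, (one_mul _).symm⟩ x v
      simpa [transl_apply] using this
    · have := hodgeLaplacian_apply hw x v
      rw [hΔ] at this
      simpa using this.symm
  have hP : ∀ ρ ∈ pointGroup2, ∀ x v, (w x fun _ => ρ v) = w x fun _ => v := fun ρ hρ x v => by
    have := formInvariant_apply hinv (γ := ρ)
      ⟨ρ, hρ, 0, lattice.zero_mem, by rw [transl_zero, mul_one]⟩ x v
    rw [isPointGroup2.apply_zero ρ hρ, sub_zero] at this
    rw [← this, hconst]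
  rw [Submodule.mem_bot]
  funext x
  ext m
  obtain ⟨v, rfl⟩ : ∃ v, m = fun _ => v := exists_eq_const m
  set L : E 3 →L[ℝ] ℂ := (ContinuousAlternatingMap.ofSubsingleton ℝ (E 3) ℂ (0 : Fin 1)).symm (w x)
  have hL : ∀ u, (w x fun _ => u) = L u := fun u => rfl
  have hsum : v + chi1 v + chi2 v + chi3 v = 0 :=
    fin3_ext (by simp) (by simp) (by simp)
  have h4 := congrArg L hsum
  rw [map_add, map_add, map_add, map_zero, ← hL, ← hL, ← hL, ← hL,
    hP chi1 (mem_pointGroup2.2 (by simp)), hP chi2 (mem_pointGroup2.2 (by simp)),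
    hP chi3 (mem_pointGroup2.2 (by simp))] at h4
  have h5 : (4 : ℂ) * (w x fun _ => v) = 0 := by rw [← h4]; ring
  simpa using h5

theorem not_isospectralOnOneForms : ¬ IsospectralOnOneForms Gam1 Gam2 := by
  intro h
  have h0 := h 0
  rw [eigenforms_gam2_eq_bot, rank_bot] at h0
  have h1 : Subsingleton (eigenforms 0 Gam1 0) := rank_zero_iff.1 h0
  exact dz_ne_zero (congrArg Subtype.val (h1.elim ⟨dz, dz_mem_eigenforms⟩ 0))

end FlatOrbifold

end

open FlatOrbifold in
theorem mainTheorem7 :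
    -- the elements of the two groups, and the orbit spaces are compact flat orbifolds
    (∀ γ : Isom 3, γ ∈ Gam1 ↔ ∃ j : ℕ, j < 4 ∧ ∃ v ∈ Lam, γ = tau ^ j * transl v) ∧
    (∀ γ : Isom 3, γ ∈ Gam2 ↔
      ∃ ρ ∈ ({1, chi1, chi2, chi3} : Set (Isom 3)), ∃ v ∈ Lam, γ = ρ * transl v) ∧
    IsCrystallographic Gam1 ∧ IsCrystallographic Gam2 ∧
    -- isospectral on functions, but not on `1`-forms
    IsospectralOnFunctions Gam1 Gam2 ∧
    ¬ IsospectralOnOneForms Gam1 Gam2 ∧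
    -- both maximal isotropy orders are four
    IsGreatest (Set.range (isotropyOrder Gam1)) 4 ∧
    IsGreatest (Set.range (isotropyOrder Gam2)) 4 ∧
    -- the maximal isotropy groups, which are not isomorphic
    (∀ q ∈ maxIsotropySet Gam1, HasIsotropy Gam1 q Z4) ∧
    (∀ q ∈ maxIsotropySet Gam2, HasIsotropy Gam2 q (Z2 × Z2)) ∧
    IsEmpty (Z4 ≃* Z2 × Z2) ∧
    -- the dimensions of the sets of points of maximal isotropy
    smallInductiveDimension (maxIsotropySet Gam1) = 1 ∧
    smallInductiveDimension (maxIsotropySet Gam2) = 0 ∧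
    -- the singular set of the first orbifold
    (∀ q : Orbifold Gam1, isotropyOrder Gam1 q ≠ 1 →
      HasIsotropy Gam1 q Z4 ∨ HasIsotropy Gam1 q Z2) ∧
    IsUnionOfCircles Gam1 {q | HasIsotropy Gam1 q Z4} 2 2 ∧
    IsUnionOfCircles Gam1 {q | HasIsotropy Gam1 q Z2} 1 2 ∧
    -- the singular set of the second orbifold
    (∀ x : E 3, HasIsotropy Gam2 (proj Gam2 x) (Z2 × Z2) ↔ ∀ i, ∃ m : ℤ, x i = m) ∧
    (∀ x : E 3, HasIsotropy Gam2 (proj Gam2 x) Z2 ↔ {i | ∃ m : ℤ, x i = m}.ncard = 2) ∧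
    (∀ q : Orbifold Gam2, isotropyOrder Gam2 q ≠ 1 →
      HasIsotropy Gam2 q (Z2 × Z2) ∨ HasIsotropy Gam2 q Z2) ∧
    {q | HasIsotropy Gam2 q (Z2 × Z2)}.ncard = 8 ∧
    IsUnionOfOpenSegments Gam2 {q | HasIsotropy Gam2 q Z2} 12 1 :=
  ⟨mem_gam1_iff, mem_gam2_iff, isCrystallographic_gam1, isCrystallographic_gam2,
    isospectralOnFunctions, not_isospectralOnOneForms,
    isGreatest_isotropyOrder1, isGreatest_isotropyOrder2,
    fun q hq => by rwa [maxIsotropySet1_eq] at hq, fun q hq => by rwa [maxIsotropySet2_eq] at hq,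
    isEmpty_Z4_mulEquiv,
    smallInductiveDimension_maxIsotropySet1, smallInductiveDimension_maxIsotropySet2,
    hasIsotropy1_of_ne_one, isUnionOfCircles_Z4, isUnionOfCircles_Z2,
    hasIsotropy2_Z2_prod_Z2_iff, hasIsotropy2_Z2_iff, hasIsotropy2_of_ne_one,
    ncard_hasIsotropy2_Z2_prod_Z2, isUnionOfOpenSegments_Z2⟩
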